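/- For $\xi=(\xi_1,\xi_2)\in\mathbb Z^2$ let $$G(k,\xi)=\frac1{2\pi}\int_{(-\pi,\pi)^2}\frac{e^{i(\sigma_1\xi_1+\sigma_2\xi_2)}}{4-2\cos\sigma_1-2\cos\sigma_2-k^2}\,d\sigma ,\qquad k\in\overline{\mathbb C}_+\setminus[-\sqrt8,\sqrt8],$$ be Green's function (in this normalization) of the operator $-\Delta-k^2$ on $\mathbb Z^2$, where $\Delta u(\xi)=\sum_{|\xi-\xi'|=1}u(\xi')-4u(\xi)$ and $\overline{\mathbb C}_+=\{k\in\mathbb C:\operatorname{Im}k\ge 0\}$. Let $k_s$, $s=0,\pm1,\pm2$, be the points $k_0=0$, $k_{\pm1}=\pm2$, $k_{\pm2}=\pm\sqrt8$. For each fixed $\xi\in\mathbb Z^2$ the following holds. For every $k\in\overline{\mathbb C}_+\setminus[-\sqrt8,\sqrt8]$ the denominator does not vanish and the integral converges absolutely, and $k\mapsto G(k,\xi)$ is analytic (in a neighborhood of each point) on $\overline{\mathbb C}_+\setminus[-\sqrt8,\sqrt8]$. Moreover, $G(\cdot,\xi)$ extends from $\overline{\mathbb C}_+\setminus[-\sqrt8,\sqrt8]$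 to a function that is analytic in a neighborhood of each point of $\overline{\mathbb C}_+\setminus\{k_0,k_{\pm1},k_{\pm2}\}$, in particular of each point of $[-\sqrt8,\sqrt8]\setminus\{k_0,k_{\pm1},k_{\pm2}\}$, and such that for each $s$ there are functions $u_{1,s}(\cdot,\xi)$, $u_{2,s}(\cdot,\xi)$, analytic in a full neighborhood of $k_s$, with $$G(k,\xi)=u_{1,s}(k,\xi)\log(k-k_s)+u_{2,s}(k,\xi)$$ for all $k$ in some neighborhood of $k_s$ cut along the ray $\{k_s-it:t\ge0\}$; here $\log$ is the branch with argument in $(-\pi/2,3\pi/2)$. -/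

import Mathlib

open Set Filter Topology MeasureTheory

namespace LatticeGreen

/-- The symbol `4 - 2 cos σ₁ - 2 cos σ₂` of minus the lattice Laplacian
`Δ u (ξ) = (∑ over the four neighbours ξ' of ξ of u (ξ')) - 4 u (ξ)` on `ℤ²`. -/
noncomputable def symbol (σ : ℝ × ℝ) : ℝ :=
  4 - 2 * Real.cos σ.1 - 2 * Real.cos σ.2

/-- The open square `(-π, π) × (-π, π)`. -/
def torusSquare : Set (ℝ × ℝ) :=
  Ioo (-Real.pi) Real.pi ×ˢ Ioo (-Real.pi) Real.pi

/-- The integrand `e^{i σ ξ} / (φ(σ) - k²)`, where `σ ξ = σ₁ ξ₁ + σ₂ ξ₂`. -/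
noncomputable def greenIntegrand (k : ℂ) (ξ : ℤ × ℤ) (σ : ℝ × ℝ) : ℂ :=
  Complex.exp (Complex.I * ((σ.1 * ξ.1 + σ.2 * ξ.2 : ℝ) : ℂ)) / ((symbol σ : ℂ) - k ^ 2)

/-- Green's function of `-Δ - k²` on `ℤ²`, with the normalising factor `1 / (2π)`. -/
noncomputable def green (k : ℂ) (ξ : ℤ × ℤ) : ℂ :=
  (1 / (2 * (Real.pi : ℂ))) * ∫ σ in torusSquare, greenIntegrand k ξ σ

/-- The closed upper half-plane. -/
def closedUpper : Set ℂ := {k | 0 ≤ k.im}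

/-- The real segment `[-√8, √8]` in the complex plane. -/
def cut : Set ℂ := {k | k.im = 0 ∧ k.re ∈ Icc (-√8 : ℝ) (√8 : ℝ)}

/-- The exceptional points `0, ±2, ±√8`. -/
noncomputable def branchPoints : Set ℂ :=
  {0, 2, -2, ((√8 : ℝ) : ℂ), -((√8 : ℝ) : ℂ)}

/-- The complex plane cut along the vertical ray `{s - i t : t ≥ 0}`. -/
def slitPlaneAt (s : ℂ) : Set ℂ := {k | ¬ (k.re = s.re ∧ k.im ≤ s.im)}

/-- The branch of the logarithm with argument in `(-π/2, 3π/2)`, analytic off the ray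
`{-i t : t ≥ 0}` and real on the positive real axis. -/
noncomputable def logBranch (z : ℂ) : ℂ :=
  Complex.log (-Complex.I * z) + Complex.I * ((Real.pi / 2 : ℝ) : ℂ)

end LatticeGreen

/-! The integral sees `k` only through `e = 1 - k²/4`, and the points `0, ±2, ±√8` correspond to `e
= 1, 0, -1`. On the diagonal `ξ = (n, n)`, rotating the torus by `π/4` turns the symbol into `4 - 4
cos c cos a`. Up to the factor `1/π`, `green k (n, n)` is then the integral of `p (sin² c) / (e -
cos c cos a)`, where `p (sin² c) = cos 2nc` is a Chebyshev polynomial in `sin² c` (`green_diag`).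

With `X = cos c cos a` as a variable this becomes the Cauchy transform over `[-1, 1]` of a density
that is even in `X` and holomorphic for `Re X > 0`. Such a transform has the form `u₁ log (e - 1) +
u₂` near the endpoint, and it continues across `(0, 1)` from either side
(`exists_diagTransform_eq_log`). Oddness in `e` carries this to `[-1, 0)`. The remaining point `e =
0`, where the density may blow up, is moved to the endpoint `1` by Jacobi's imaginary modulus
transformation `e ↦ √(1 - e²)`, which replaces `p z` by `p (1 - z)` (`diagTransform_eq_conjParam`).

Each real `x` thus has a local representation by a logarithm and analytic coefficients, valid from
the upper half plane, and the identity theorem glues these into one extension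
(`hasLogExtension_of_hasLogSingularity`). Functions with such an extension are closed under sums and
under multiplication by entire functions, so the difference equation and the symmetries of the
lattice propagate the property from the diagonal to every `ξ` (`hasLogExtension_green_of_sub_eq`).
-/

/-! ### Holomorphic parameter integrals and Cauchy transforms. -/

/-- An integral of a kernel depending holomorphically on a parameter, over a subset of a compact
set and against an integrable weight, is holomorphic in the parameter. -/
theorem differentiableOn_integral_mul {α : Type*} [TopologicalSpace α] [MeasurableSpace α]
    [OpensMeasurableSpace α] [SecondCountableTopologyEither α ℂ]
    {μ : Measure α} {Ω : Set ℂ} (hΩ : IsOpen Ω)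
    {K s : Set α} (hK : IsCompact K) (hs : MeasurableSet s) (hsK : s ⊆ K) {w : α → ℂ}
    (hw : IntegrableOn w s μ) {F : ℂ → α → ℂ}
    (hF : ContinuousOn (Function.uncurry F) (Ω ×ˢ K))
    (hd : ∀ x ∈ K, DifferentiableOn ℂ (fun z => F z x) Ω) :
    DifferentiableOn ℂ (fun z => ∫ x in s, w x * F z x ∂μ) Ω := by
  intro z₀ hz₀
  obtain ⟨r, hr, hball⟩ := Metric.isOpen_iff.1 hΩ z₀ hz₀
  have hcl : Metric.closedBall z₀ (r / 2) ⊆ Ω :=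
    (Metric.closedBall_subset_ball (by linarith)).trans hball
  have hcomp : IsCompact (Metric.closedBall z₀ (r / 2) ×ˢ K) :=
    (isCompact_closedBall z₀ (r / 2)).prod hK
  obtain ⟨C, hC⟩ := hcomp.exists_bound_of_continuousOn (hF.mono (prod_mono hcl subset_rfl))
  have hFm : ∀ z ∈ Ω, ContinuousOn (F z) s := fun z hz =>
    (hF.comp (f := fun x => (z, x)) (by fun_prop) (fun x hx => ⟨hz, hsK hx⟩))
  have hdiff : ∀ x ∈ K, ∀ z ∈ Ω, HasDerivAt (fun z => F z x) (deriv (fun z => F z x) z) z :=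
    fun x hx z hz => ((hd x hx).differentiableAt (hΩ.mem_nhds hz)).hasDerivAt
  have hmem : ∀ᵐ x ∂(μ.restrict s), x ∈ s := ae_restrict_mem hs
  have hsub : Metric.ball z₀ (r / 4) ⊆ Ω :=
    (Metric.ball_subset_ball (by linarith)).trans hball
  have hbd : ∀ z ∈ Metric.closedBall z₀ (r / 2), ∀ x ∈ s, ‖F z x‖ ≤ C := fun z hz x hx =>
    hC (z, x) ⟨hz, hsK hx⟩
  refine ((hasDerivAt_integral_of_dominated_loc_of_deriv_le
    (F := fun z x => w x * F z x) (F' := fun z x => w x * deriv (fun z => F z x) z)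
    (bound := fun x => ‖w x‖ * (C / (r / 4))) (s := Metric.ball z₀ (r / 4))
    (Metric.ball_mem_nhds _ (by linarith)) ?_ ?_ ?_ ?_ ?_ ?_).2).differentiableAt.differentiableWithinAt
  · filter_upwards [hΩ.mem_nhds hz₀] with z hz
    exact hw.aestronglyMeasurable.mul ((hFm z hz).aestronglyMeasurable hs)
  · refine Integrable.mul_bdd (c := C) hw ((hFm z₀ hz₀).aestronglyMeasurable hs) ?_
    filter_upwards [hmem] with x hx
    exact hbd z₀ (Metric.mem_closedBall_self (by linarith)) x hx
  · refine hw.aestronglyMeasurable.mul ?_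
    -- The derivative in `z` is measurable in `x` as a pointwise limit of difference quotients along
    -- this null sequence, whose steps keep `z₀ + t n` in the ball.
    let t : ℕ → ℂ := fun n => ((r / 4 / (n + 1) : ℝ) : ℂ)
    have ht0 : Tendsto t atTop (𝓝 0) := by
      have h1 : Tendsto (fun n : ℕ => r / 4 * (1 / ((n : ℝ) + 1))) atTop (𝓝 (r / 4 * 0)) :=
        tendsto_one_div_add_atTop_nhds_zero_nat.const_mul _
      rw [mul_zero] at h1
      have h2 := (Complex.continuous_ofReal.tendsto 0).comp h1
      refine (h2.congr fun n => ?_)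
      simp only [t, Function.comp]
      congr 1
      ring
    have htne : ∀ n, t n ≠ 0 := fun n => by
      simp only [t]
      exact_mod_cast (by positivity : r / 4 / ((n : ℝ) + 1) ≠ 0)
    have htn : Tendsto t atTop (𝓝[≠] 0) :=
      tendsto_nhdsWithin_iff.2 ⟨ht0, Eventually.of_forall htne⟩
    have htΩ : ∀ n, z₀ + t n ∈ Ω := fun n => by
      apply hball
      rw [Metric.mem_ball, dist_eq_norm, add_sub_cancel_left]
      simp only [t]
      rw [Complex.norm_real, Real.norm_eq_abs, abs_of_pos (by positivity)]
      have : r / 4 / ((n : ℝ) + 1) ≤ r / 4 := div_le_self (by linarith) (by linarith [n.cast_nonneg (α := ℝ)])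
      linarith
    refine aestronglyMeasurable_of_tendsto_ae atTop
      (f := fun n x => (t n)⁻¹ • (F (z₀ + t n) x - F z₀ x)) (fun n => ?_) ?_
    · exact AEStronglyMeasurable.const_smul (((hFm _ (htΩ n)).aestronglyMeasurable hs).sub
        ((hFm _ hz₀).aestronglyMeasurable hs)) ((t n)⁻¹)
    · filter_upwards [hmem] with x hx
      exact ((hdiff x (hsK hx) z₀ hz₀).tendsto_slope_zero).comp htn
  · filter_upwards [hmem] with x hx z hz
    rw [norm_mul]
    refine mul_le_mul_of_nonneg_left ?_ (norm_nonneg _)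
    -- Cauchy's estimate: circles of radius `r / 4` about points of the ball of radius `r / 4` stay
    -- in the closed ball of radius `r / 2`, where `F` is bounded by `C`.
    refine Complex.norm_deriv_le_of_forall_mem_sphere_norm_le (by linarith) ?_ ?_
    · refine ((hd x (hsK hx)).mono ?_).diffContOnCl
      refine (Metric.closure_ball_subset_closedBall).trans ?_
      refine (Metric.closedBall_subset_closedBall' ?_).trans hcl
      rw [Metric.mem_ball] at hz; linarith
    · intro u hu
      refine hbd u ?_ x hx
      rw [Metric.mem_closedBall]
      rw [Metric.mem_sphere] at hu
      rw [Metric.mem_ball] at hz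
      linarith [dist_triangle u z z₀]
  · exact hw.norm.mul_const _
  · filter_upwards [hmem] with x hx z hz
    exact (hdiff x (hsK hx) z (hsub hz)).const_mul _

theorem differentiableOn_setIntegral {α : Type*} [TopologicalSpace α] [MeasurableSpace α]
    [OpensMeasurableSpace α] [SecondCountableTopologyEither α ℂ]
    {μ : Measure α} [IsFiniteMeasureOnCompacts μ] {Ω : Set ℂ} (hΩ : IsOpen Ω)
    {K s : Set α} (hK : IsCompact K) (hs : MeasurableSet s) (hsK : s ⊆ K) {F : ℂ → α → ℂ}
    (hF : ContinuousOn (Function.uncurry F) (Ω ×ˢ K))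
    (hd : ∀ x ∈ K, DifferentiableOn ℂ (fun z => F z x) Ω) :
    DifferentiableOn ℂ (fun z => ∫ x in s, F z x ∂μ) Ω := by
  have h := differentiableOn_integral_mul (μ := μ) hΩ hK hs hsK (w := fun _ => 1)
    (integrableOn_const (ne_top_of_le_ne_top hK.measure_lt_top.ne (measure_mono hsK))) hF hd
  simpa using h

namespace LatticeGreen

theorem sub_ofReal_mem_slitPlane {e : ℂ} (he : e - 1 ∈ Complex.slitPlane) {x : ℝ}
    (hx : x ≤ 1) : e - x ∈ Complex.slitPlane := by
  rw [Complex.mem_slitPlane_iff] at he ⊢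
  simp only [Complex.sub_re, Complex.one_re, Complex.sub_im, Complex.one_im, Complex.ofReal_re,
    Complex.ofReal_im] at he ⊢
  exact he.imp (fun h => by linarith) id

/-- The Cauchy transform of a holomorphic density has a logarithmic singularity at the end
point of the interval. -/
theorem exists_cauchyTransform_eq_log {ρ : ℂ → ℂ} {c : ℝ} (hc1 : c < 1) {W : Set ℂ}
    (hW : IsOpen W) (hWc : Convex ℝ W) (hcW : ∀ x ∈ Icc c 1, (x : ℂ) ∈ W)
    (hρ : DifferentiableOn ℂ ρ W) :
    ∃ u : ℂ → ℂ, DifferentiableOn ℂ u (W ∩ {e | c < e.re}) ∧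
      ∀ e ∈ W ∩ {e : ℂ | c < e.re}, e - 1 ∈ Complex.slitPlane →
        ∫ x in Ioc c 1, ρ x * (e - x)⁻¹ = -ρ e * Complex.log (e - 1) + u e := by
  have hρ' : DifferentiableOn ℂ (deriv ρ) W := hρ.deriv hW
  have hseg : ∀ e ∈ W, ∀ x ∈ Icc c 1, ∀ t ∈ Icc (0 : ℝ) 1, e + t * ((x : ℂ) - e) ∈ W := by
    intro e he x hx t ht
    have := hWc he (hcW x hx) (sub_nonneg.2 ht.2) ht.1 (by ring)
    convert this using 1
    simp only [Complex.real_smul]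
    push_cast
    ring
  -- Integrating `Q` over `t` gives the divided difference `(ρ x - ρ e) / (x - e)`, in a form that
  -- stays holomorphic when `e` crosses the interval.
  let Q : ℂ → ℝ × ℝ → ℂ := fun e y => deriv ρ (e + y.2 * ((y.1 : ℂ) - e))
  have hQc : ContinuousOn (Function.uncurry Q) (W ×ˢ (Icc c 1 ×ˢ Icc (0 : ℝ) 1)) := by
    refine hρ'.continuousOn.comp (f := fun q : ℂ × ℝ × ℝ => q.1 + q.2.2 * ((q.2.1 : ℂ) - q.1))
      (by fun_prop) ?_
    rintro ⟨e, x, t⟩ ⟨he, hx, ht⟩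
    exact hseg e he x hx t ht
  have hQd : ∀ y ∈ Icc c 1 ×ˢ Icc (0 : ℝ) 1, DifferentiableOn ℂ (fun e => Q e y) W := by
    rintro ⟨x, t⟩ ⟨hx, ht⟩
    exact hρ'.comp (f := fun e => e + t * ((x : ℂ) - e)) (by fun_prop)
      (fun e he => hseg e he x hx t ht)
  have hD : DifferentiableOn ℂ (fun e => ∫ y in Ioc c 1 ×ˢ Ioc (0 : ℝ) 1, Q e y) W :=
    differentiableOn_setIntegral hW (isCompact_Icc.prod isCompact_Icc)
      (measurableSet_Ioc.prod measurableSet_Ioc)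
      (prod_mono Ioc_subset_Icc_self Ioc_subset_Icc_self) hQc hQd
  -- Split `ρ x = ρ e + (ρ x - ρ e)`. The first term integrates to `ρ e * (log (e - c) - log (e -
  -- 1))`, with `log (e - c)` regular for `Re e > c`; the second gives minus the divided difference.
  refine ⟨fun e => ρ e * Complex.log (e - c) - ∫ y in Ioc c 1 ×ˢ Ioc (0 : ℝ) 1, Q e y, ?_, ?_⟩
  · refine ((hρ.mono inter_subset_left).mul ?_).sub (hD.mono inter_subset_left)
    intro e he
    have : e - c ∈ Complex.slitPlane := Or.inl (by simpa using he.2)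
    exact (DifferentiableAt.clog (f := fun e => e - (c : ℂ)) (by fun_prop) this).differentiableWithinAt
  · rintro e ⟨heW, hec⟩ he
    have hQint : IntegrableOn (Q e) (Ioc c 1 ×ˢ Ioc (0 : ℝ) 1) := by
      refine IntegrableOn.mono_set ?_ (prod_mono Ioc_subset_Icc_self Ioc_subset_Icc_self)
      refine ContinuousOn.integrableOn_compact (isCompact_Icc.prod isCompact_Icc) ?_
      exact hQc.comp (f := fun y => (e, y)) (by fun_prop) (fun y hy => ⟨heW, hy⟩)
    have hslit : ∀ x ∈ Icc c 1, e - x ∈ Complex.slitPlane := fun x hx =>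
      sub_ofReal_mem_slitPlane he hx.2
    have hne : ∀ x ∈ Icc c 1, e - x ≠ 0 := fun x hx => Complex.slitPlane_ne_zero (hslit x hx)
    have hcont : ContinuousOn (fun x : ℝ => (e - (x : ℂ))⁻¹) (uIcc c 1) := by
      rw [uIcc_of_le hc1.le]
      exact ContinuousOn.inv₀ (by fun_prop) hne
    have hlog : ∫ x in c..1, (e - (x : ℂ))⁻¹ = Complex.log (e - c) - Complex.log (e - 1) := by
      have := intervalIntegral.integral_eq_sub_of_hasDerivAt (a := c) (b := 1)
        (f := fun x : ℝ => -Complex.log (e - x)) (f' := fun x : ℝ => (e - (x : ℂ))⁻¹) ?_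
        hcont.intervalIntegrable
      · rw [this]; push_cast; ring
      · intro x hx
        rw [uIcc_of_le hc1.le] at hx
        have h1 : HasDerivAt (fun x : ℝ => e - (x : ℂ)) (-1) x :=
          (Complex.ofRealCLM.hasDerivAt (x := x)).const_sub e
        have := (h1.clog_real (hslit x hx)).neg
        rw [← neg_div, neg_neg, one_div] at this
        exact this
    have hdiff : ∀ x ∈ Icc c 1, ∫ t in (0 : ℝ)..1, Q e (x, t) = (ρ x - ρ e) / (x - e) := by
      intro x hx
      have hxe : (x : ℂ) - e ≠ 0 := by
        rw [← neg_sub]; exact neg_ne_zero.2 (hne x hx)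
      have h0 : ∫ t in (0 : ℝ)..1, Q e (x, t) * ((x : ℂ) - e) = ρ x - ρ e := by
        have := intervalIntegral.integral_eq_sub_of_hasDerivAt (a := 0) (b := 1)
          (f := fun t : ℝ => ρ (e + t * ((x : ℂ) - e)))
          (f' := fun t : ℝ => Q e (x, t) * ((x : ℂ) - e)) ?_ ?_
        · rw [this]; simp
        · intro t ht
          rw [uIcc_of_le zero_le_one] at ht
          have h1 : HasDerivAt (fun t : ℝ => e + t * ((x : ℂ) - e)) ((x : ℂ) - e) t := by
            have := ((Complex.ofRealCLM.hasDerivAt (x := t)).mul_const ((x : ℂ) - e)).const_add e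
            simpa using this
          have h2 := (hρ.differentiableAt (hW.mem_nhds (hseg e heW x hx t ht))).hasDerivAt
          have := h2.comp_of_eq t h1 rfl
          exact this
        · refine ContinuousOn.intervalIntegrable ?_
          rw [uIcc_of_le zero_le_one]
          refine ContinuousOn.mul ?_ continuousOn_const
          exact hQc.comp (f := fun t : ℝ => (e, x, t)) (by fun_prop) (fun t ht => ⟨heW, hx, ht⟩)
      rw [eq_div_iff hxe, ← h0, intervalIntegral.integral_mul_const]
    have hfub : ∫ y in Ioc c 1 ×ˢ Ioc (0 : ℝ) 1, Q e y
        = ∫ x in Ioc c 1, (ρ x - ρ e) / (x - e) := by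
      rw [Measure.volume_eq_prod, setIntegral_prod _ (by rwa [Measure.volume_eq_prod] at hQint)]
      refine setIntegral_congr_fun measurableSet_Ioc fun x hx => ?_
      rw [← hdiff x (Ioc_subset_Icc_self hx), intervalIntegral.integral_of_le zero_le_one]
    simp only
    rw [hfub]
    have hI1 : IntegrableOn (fun x : ℝ => ρ e * (e - (x : ℂ))⁻¹) (Ioc c 1) := by
      have := (hcont.intervalIntegrable (μ := volume)).1
      exact this.const_mul _
    have hI2 : IntegrableOn (fun x : ℝ => (ρ x - ρ e) / ((x : ℂ) - e)) (Ioc c 1) := by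
      refine IntegrableOn.mono_set ?_ Ioc_subset_Icc_self
      refine ContinuousOn.integrableOn_Icc ?_
      refine ContinuousOn.div ?_ (by fun_prop) ?_
      · refine ContinuousOn.sub ?_ continuousOn_const
        exact hρ.continuousOn.comp (by fun_prop) hcW
      · intro x hx
        rw [← neg_sub]; exact neg_ne_zero.2 (hne x hx)
    have hsplit : ∫ x in Ioc c 1, ρ x * (e - (x : ℂ))⁻¹
        = ∫ x in Ioc c 1, (ρ e * (e - (x : ℂ))⁻¹ - (ρ x - ρ e) / ((x : ℂ) - e)) := by
      refine setIntegral_congr_fun measurableSet_Ioc fun x hx => ?_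
      have h1 := hne x (Ioc_subset_Icc_self hx)
      have h2 : (x : ℂ) - e ≠ 0 := by
        rw [← neg_sub]; exact neg_ne_zero.2 h1
      rw [show (x : ℂ) - e = -(e - x) by ring]
      field_simp
      ring
    rw [hsplit, integral_sub hI1 hI2, integral_const_mul, ← intervalIntegral.integral_of_le hc1.le,
      hlog]
    ring

/-! ### The branch of the logarithm cut along the downward ray. -/

theorem exp_logBranch {z : ℂ} (hz : z ≠ 0) : Complex.exp (logBranch z) = z := by
  have h : Complex.exp (Complex.I * ((Real.pi / 2 : ℝ) : ℂ)) = Complex.I := by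
    rw [mul_comm]; push_cast; exact Complex.exp_pi_div_two_mul_I
  rw [logBranch, Complex.exp_add, Complex.exp_log (by simp [hz]), h]
  linear_combination -z * Complex.I_mul_I

theorem neg_I_mul_mem_slitPlane {z : ℂ} (hz : ¬ (z.re = 0 ∧ z.im ≤ 0)) :
    -Complex.I * z ∈ Complex.slitPlane := by
  rw [Complex.mem_slitPlane_iff]
  simp
  by_contra! h
  exact hz ⟨h.2, h.1⟩

theorem differentiableAt_logBranch {z : ℂ} (hz : ¬ (z.re = 0 ∧ z.im ≤ 0)) :
    DifferentiableAt ℂ logBranch z := by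
  unfold logBranch
  refine DifferentiableAt.add_const _ ?_
  exact (Complex.differentiableAt_log (neg_I_mul_mem_slitPlane hz)).comp z (by fun_prop)

/-- A logarithm of `(k - s) ^ N * q k` along the upper half plane. -/
theorem exists_log_eq_logBranch {s : ℝ} {P q : ℂ → ℂ} {N : ℕ} (hq : AnalyticAt ℂ q s)
    (hq0 : q s ≠ 0)
    (hP : ∀ᶠ k in 𝓝[{k : ℂ | 0 < k.im}] (s : ℂ), P k = (k - s) ^ N * q k)
    (hslit : ∀ᶠ k in 𝓝[{k : ℂ | 0 < k.im}] (s : ℂ), P k ∈ Complex.slitPlane) :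
    ∃ v : ℂ → ℂ, AnalyticAt ℂ v s ∧ ∀ᶠ k in 𝓝[{k : ℂ | 0 < k.im}] (s : ℂ),
      Complex.log (P k) = N * logBranch (k - s) + v k := by
  -- Dividing by `q s` puts the argument near `1`, so this is an analytic logarithm of `q` near `s`
  -- wherever `q s` lies.
  let v₀ : ℂ → ℂ := fun k => Complex.log (q k / q s) + Complex.log (q s)
  have hv₀ : AnalyticAt ℂ v₀ s := by
    refine AnalyticAt.add (AnalyticAt.clog (by fun_prop (disch := assumption)) ?_) analyticAt_const
    rw [div_self hq0]; exact Complex.one_mem_slitPlane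
  have hexp : ∀ k, q k ≠ 0 → Complex.exp (v₀ k) = q k := fun k hk => by
    simp only [v₀]
    rw [Complex.exp_add, Complex.exp_log (div_ne_zero hk hq0), Complex.exp_log hq0,
      div_mul_cancel₀ _ hq0]
  have hev := (hq.eventually_analyticAt.and (hv₀.eventually_analyticAt.and
    (hq.continuousAt.eventually_ne hq0)))
  rw [eventually_nhdsWithin_iff] at hP hslit
  obtain ⟨r, hr, hball⟩ := Metric.eventually_nhds_iff_ball.1 (hev.and (hP.and hslit))
  set V : Set ℂ := Metric.ball (s : ℂ) r ∩ {k : ℂ | 0 < k.im} with hV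
  have hVo : IsOpen V := Metric.isOpen_ball.inter (isOpen_lt continuous_const Complex.continuous_im)
  have hVc : Convex ℝ V := (convex_ball _ _).inter (convex_halfSpace_im_gt 0)
  have hlogB : ∀ k ∈ V, ¬ ((k - (s : ℂ)).re = 0 ∧ (k - (s : ℂ)).im ≤ 0) := by
    rintro k ⟨-, hk⟩ ⟨-, h⟩
    simp at h hk
    linarith
  have hne : ∀ k ∈ V, k - (s : ℂ) ≠ 0 := by
    intro k hk h
    exact hlogB k hk (by simp [h])
  -- Both candidates are logarithms of the same function, so `exp D = 1`, whence `D' = 0`; the half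
  -- ball `V` is convex, so `D` is constant there.
  let D : ℂ → ℂ := fun k => Complex.log ((k - s) ^ N * q k) - N * logBranch (k - s) - v₀ k
  have hDd : DifferentiableOn ℂ D V := by
    intro k hk
    obtain ⟨⟨h1, h2, h3⟩, h4, h5⟩ := hball k hk.1
    have hq' := h1.differentiableAt
    have h6 : (k - s) ^ N * q k ∈ Complex.slitPlane := by rw [← h4 hk.2]; exact h5 hk.2
    refine DifferentiableAt.differentiableWithinAt ?_
    refine ((DifferentiableAt.clog (f := fun k => (k - (s : ℂ)) ^ N * q k) (by fun_prop) h6).sub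
      (DifferentiableAt.const_mul ?_ _)).sub h2.differentiableAt
    exact DifferentiableAt.comp (g := logBranch) (f := fun k => k - (s : ℂ)) k
      (differentiableAt_logBranch (hlogB k hk)) (by fun_prop)
  have hDe : ∀ k ∈ V, Complex.exp (D k) = 1 := by
    intro k hk
    obtain ⟨⟨h1, h2, h3⟩, h4, h5⟩ := hball k hk.1
    simp only [D]
    rw [Complex.exp_sub, Complex.exp_sub, Complex.exp_nat_mul, exp_logBranch (hne k hk),
      hexp k h3, Complex.exp_log (mul_ne_zero (pow_ne_zero _ (hne k hk)) h3)]
    have := pow_ne_zero N (hne k hk)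
    field_simp
  have hD0 : ∀ k ∈ V, deriv D k = 0 := by
    intro k hk
    have hd := (hDd.differentiableAt (hVo.mem_nhds hk)).hasDerivAt.cexp
    have hc : HasDerivAt (fun k => Complex.exp (D k)) 0 k := by
      refine (hasDerivAt_const k (1 : ℂ)).congr_of_eventuallyEq ?_
      filter_upwards [hVo.mem_nhds hk] with z hz using hDe z hz
    have := hd.unique hc
    rwa [hDe k hk, one_mul] at this
  obtain ⟨a, ha⟩ : ∃ a, ∀ k ∈ V, D k = a :=
    hVo.exists_is_const_of_deriv_eq_zero hVc.isPreconnected hDd hD0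
  refine ⟨fun k => v₀ k + a, hv₀.add analyticAt_const, ?_⟩
  rw [eventually_nhdsWithin_iff]
  filter_upwards [Metric.ball_mem_nhds (s : ℂ) hr] with k hk hk'
  rw [((hball k hk).2.1 hk'), ← ha k ⟨hk, hk'⟩]
  simp only [D]
  ring

end LatticeGreen

/-! ### Elementary trigonometric integrals. -/

/-- The antiderivative is `arctan (l tan b) / (l A)` with `l = √(B / A)`. It has no continuous
formula at `π / 2`, so its limit there is used. -/
theorem integral_inv_cos_sq_add_sin_sq {A B : ℝ} (hA : 0 < A) (hB : 0 < B) :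
    ∫ b in (0 : ℝ)..(Real.pi / 2), (A * Real.cos b ^ 2 + B * Real.sin b ^ 2)⁻¹
      = Real.pi / (2 * √(A * B)) := by
  have hpos : ∀ b : ℝ, 0 < A * Real.cos b ^ 2 + B * Real.sin b ^ 2 := by
    intro b
    rcases eq_or_ne (Real.cos b) 0 with h | h
    · have := Real.sin_sq_add_cos_sq b
      rw [h] at this ⊢
      have h1 : Real.sin b ^ 2 = 1 := by linarith
      rw [h1]; simp [hB]
    · have := Real.sin_sq_add_cos_sq b
      positivity
  set l : ℝ := √(B / A) with hl
  have hlpos : 0 < l := Real.sqrt_pos.2 (div_pos hB hA)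
  have hl2 : l ^ 2 = B / A := Real.sq_sqrt (div_pos hB hA).le
  have hlA : l * A = √(A * B) := by
    rw [eq_comm, Real.sqrt_eq_iff_mul_self_eq (by positivity) (by positivity)]
    have : l * A * (l * A) = l ^ 2 * A ^ 2 := by ring
    rw [this, hl2]; field_simp
  have hf := intervalIntegral.integral_eq_sub_of_hasDerivAt_of_tendsto
    (a := 0) (b := Real.pi / 2) (f := fun b => (l * A)⁻¹ * Real.arctan (l * Real.tan b))
    (f' := fun b => (A * Real.cos b ^ 2 + B * Real.sin b ^ 2)⁻¹)
    (fa := 0) (fb := (l * A)⁻¹ * (Real.pi / 2)) (by positivity) ?_ ?_ ?_ ?_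
  · rw [hf, hlA]; field_simp; ring
  · intro b hb
    have hc : Real.cos b ≠ 0 :=
      (Real.cos_pos_of_mem_Ioo ⟨by linarith [hb.1, Real.pi_pos], hb.2⟩).ne'
    have h1 := (((Real.hasDerivAt_tan hc).const_mul l).arctan).const_mul (l * A)⁻¹
    refine h1.congr_deriv (Eq.symm ?_)
    rw [Real.tan_eq_sin_div_cos]
    have h2 := hpos b
    have h3 : 1 + (l * (Real.sin b / Real.cos b)) ^ 2
        = (A * Real.cos b ^ 2 + B * Real.sin b ^ 2) / (A * Real.cos b ^ 2) := by
      rw [mul_pow, hl2]; field_simp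
    rw [h3]
    field_simp
  · refine ContinuousOn.intervalIntegrable (Continuous.continuousOn ?_)
    exact Continuous.inv₀ (by fun_prop) (fun b => (hpos b).ne')
  · have : ContinuousAt (fun b => (l * A)⁻¹ * Real.arctan (l * Real.tan b)) 0 := by
      have : ContinuousAt Real.tan 0 := Real.continuousAt_tan.2 (by simp)
      exact ((Real.continuous_arctan.continuousAt.comp (this.const_mul l))).const_mul _
    have h := this.tendsto
    simp only [Real.tan_zero, mul_zero, Real.arctan_zero] at h
    exact h.mono_left nhdsWithin_le_nhds
  · refine Tendsto.const_mul _ ?_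
    have h1 : Tendsto (fun b => l * Real.tan b) (𝓝[<] (Real.pi / 2)) atTop :=
      Real.tendsto_tan_pi_div_two.const_mul_atTop hlpos
    exact (Real.tendsto_arctan_atTop.mono_right nhdsWithin_le_nhds).comp h1

/-- Half-angle substitution `a = 2b`. -/
theorem integral_inv_sub_mul_cos {α β : ℝ} (h1 : β < α) (h2 : -α < β) :
    ∫ a in (0 : ℝ)..Real.pi, (α - β * Real.cos a)⁻¹ = Real.pi / √(α ^ 2 - β ^ 2) := by
  have h := intervalIntegral.integral_comp_mul_left (a := 0) (b := Real.pi / 2)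
    (fun a : ℝ => (α - β * Real.cos a)⁻¹) (two_ne_zero)
  rw [mul_zero, mul_div_cancel₀ _ two_ne_zero] at h
  have h3 := integral_inv_cos_sq_add_sin_sq (A := α - β) (B := α + β) (by linarith) (by linarith)
  have h4 : ∀ b : ℝ, (α - β * Real.cos (2 * b))⁻¹
      = ((α - β) * Real.cos b ^ 2 + (α + β) * Real.sin b ^ 2)⁻¹ := by
    intro b
    rw [Real.cos_two_mul, Real.sin_sq]
    ring_nf
  simp only [h4] at h
  rw [h3, smul_eq_mul] at h
  rw [show (α - β) * (α + β) = α ^ 2 - β ^ 2 by ring] at h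
  have h5 : Real.pi / √(α ^ 2 - β ^ 2) = 2 * (Real.pi / (2 * √(α ^ 2 - β ^ 2))) := by ring
  rw [h5, h]; ring

/-- The integrand is symmetric about `π / 2`, which folds the range onto `[0, π / 2]`. -/
theorem integral_inv_sq_add_sq_mul_cos_sq {y C : ℝ} (hy : 0 < y) :
    ∫ a in (0 : ℝ)..Real.pi, (y ^ 2 + C ^ 2 * Real.cos a ^ 2)⁻¹
      = Real.pi / (y * √(y ^ 2 + C ^ 2)) := by
  have h3 := integral_inv_cos_sq_add_sin_sq (A := y ^ 2 + C ^ 2) (B := y ^ 2) (by positivity) (by positivity)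
  have h4 : ∀ b : ℝ, ((y ^ 2 + C ^ 2) * Real.cos b ^ 2 + y ^ 2 * Real.sin b ^ 2)⁻¹
      = (y ^ 2 + C ^ 2 * Real.cos b ^ 2)⁻¹ := by
    intro b
    rw [Real.sin_sq]
    ring_nf
  simp only [h4] at h3
  have hc : Continuous fun b : ℝ => (y ^ 2 + C ^ 2 * Real.cos b ^ 2)⁻¹ :=
    Continuous.inv₀ (by fun_prop) (fun b => by positivity)
  have h5 := intervalIntegral.integral_comp_sub_left (a := Real.pi / 2) (b := Real.pi)
    (fun a : ℝ => (y ^ 2 + C ^ 2 * Real.cos a ^ 2)⁻¹) Real.pi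
  simp only [Real.cos_pi_sub, neg_sq, sub_self] at h5
  rw [show Real.pi - Real.pi / 2 = Real.pi / 2 by ring] at h5
  rw [← intervalIntegral.integral_add_adjacent_intervals (b := Real.pi / 2)
    (hc.intervalIntegrable _ _) (hc.intervalIntegrable _ _), h5, h3,
    Real.sqrt_mul (by positivity), Real.sqrt_sq hy.le]
  field_simp
  ring

namespace LatticeGreen

/-- Pairing `a` with `π - a` cancels the real parts and leaves `2 i y / (y² + C² cos² a)`. -/
theorem integral_inv_neg_I_mul_sub {y C : ℝ} (hy : 0 < y) :
    ∫ a in (0 : ℝ)..Real.pi, (-Complex.I * y - C * (Real.cos a : ℂ))⁻¹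
      = Complex.I * ((Real.pi / √(y ^ 2 + C ^ 2) : ℝ) : ℂ) := by
  have hne : ∀ x : ℝ, -Complex.I * y - (x : ℂ) ≠ 0 := by
    intro x h
    have := congrArg Complex.im h
    simp at this
    exact hy.ne' this
  set f : ℝ → ℂ := fun a => (-Complex.I * y - C * (Real.cos a : ℂ))⁻¹ with hf
  have hc : Continuous f := by
    refine Continuous.inv₀ (by fun_prop) (fun a => ?_)
    have := hne (C * Real.cos a)
    push_cast at this
    simpa using this
  have h5 := intervalIntegral.integral_comp_sub_left (a := 0) (b := Real.pi) f Real.pi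
  rw [sub_self, sub_zero] at h5
  have h6 : ∫ a in (0 : ℝ)..Real.pi, (f (Real.pi - a) + f a)
      = ∫ a in (0 : ℝ)..Real.pi, 2 * Complex.I * y * (((y ^ 2 + C ^ 2 * Real.cos a ^ 2)⁻¹ : ℝ) : ℂ) := by
    refine intervalIntegral.integral_congr fun a _ => ?_
    have h7 := hne (C * Real.cos a)
    have h8 := hne (-(C * Real.cos a))
    simp only [hf, Real.cos_pi_sub]
    push_cast at h7 h8 ⊢
    rw [mul_neg, inv_add_inv (by simpa using h8) (by simpa using h7),
      show (-Complex.I * y - -((C : ℂ) * Complex.cos a)) * (-Complex.I * y - C * Complex.cos a)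
        = -(y ^ 2 + C ^ 2 * Complex.cos a ^ 2) by linear_combination (y : ℂ) ^ 2 * Complex.I_sq,
      div_neg, ← neg_div, div_eq_mul_inv]
    ring
  rw [intervalIntegral.integral_add (f := fun a => f (Real.pi - a))
    ((hc.comp (g := f) (f := fun a => Real.pi - a) (by fun_prop)).intervalIntegrable _ _)
    (hc.intervalIntegrable _ _), h5, intervalIntegral.integral_const_mul,
    intervalIntegral.integral_ofReal, integral_inv_sq_add_sq_mul_cos_sq hy] at h6
  have hs : (0 : ℝ) < √(y ^ 2 + C ^ 2) := Real.sqrt_pos.2 (by positivity)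
  have hy' : (y : ℂ) ≠ 0 := by exact_mod_cast hy.ne'
  have hs' : ((√(y ^ 2 + C ^ 2) : ℝ) : ℂ) ≠ 0 := by exact_mod_cast hs.ne'
  rw [← two_mul, mul_assoc 2, mul_assoc 2] at h6
  rw [mul_left_cancel₀ two_ne_zero h6]
  push_cast
  field_simp

theorem integral_inv_ofReal_sub {E C : ℝ} (h1 : C < E) (h2 : -E < C) :
    ∫ a in (0 : ℝ)..Real.pi, ((E : ℂ) - C * (Real.cos a : ℂ))⁻¹
      = ((Real.pi / √(E ^ 2 - C ^ 2) : ℝ) : ℂ) := by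
  rw [← integral_inv_sub_mul_cos h1 h2, ← intervalIntegral.integral_ofReal]
  refine intervalIntegral.integral_congr fun a _ => ?_
  push_cast
  rfl


/-! ### The change of variable `X = cos c cos a`. -/

/-- The kernel `(cos² c - X²)^{-1/2}`, zero for `|X| ≥ cos c`. -/
noncomputable def arcKernel (c X : ℝ) : ℝ := (√(Real.cos c ^ 2 - X ^ 2))⁻¹

/-- The (complexified) density, in the variable `X = cos c cos a`, of `p (sin² c) da dc`. -/
noncomputable def density (p : ℂ → ℂ) (X : ℂ) : ℂ :=
  ∫ φ in Ioo 0 (Real.pi / 2), p ((1 - X ^ 2) * Real.sin φ ^ 2) *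
    (1 - (1 - X ^ 2) * Real.sin φ ^ 2) ^ (-(1 / 2) : ℂ)

theorem image_cos_mul {c : ℝ} (hc : 0 < Real.cos c) :
    (fun a => Real.cos c * Real.cos a) '' Ioo 0 Real.pi = Ioo (-Real.cos c) (Real.cos c) := by
  ext X
  constructor
  · rintro ⟨a, ha, rfl⟩
    have h1 : Real.cos a < 1 := by
      rw [← Real.cos_zero]
      exact Real.strictAntiOn_cos ⟨le_rfl, Real.pi_pos.le⟩ (Ioo_subset_Icc_self ha) ha.1
    have h2 : -1 < Real.cos a := by
      rw [← Real.cos_pi]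
      exact Real.strictAntiOn_cos (Ioo_subset_Icc_self ha) ⟨Real.pi_pos.le, le_rfl⟩ ha.2
    constructor <;> simp only <;> nlinarith
  · rintro ⟨h1, h2⟩
    have h3 : -1 < X / Real.cos c := by rw [lt_div_iff₀ hc]; linarith
    have h4 : X / Real.cos c < 1 := by rw [div_lt_iff₀ hc]; linarith
    refine ⟨Real.arccos (X / Real.cos c), ⟨Real.arccos_pos.2 h4, ?_⟩, ?_⟩
    · refine lt_of_le_of_ne (Real.arccos_le_pi _) fun h => ?_
      rw [Real.arccos_eq_pi] at h
      linarith
    · simp only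
      rw [Real.cos_arccos h3.le h4.le]
      field_simp

theorem injOn_cos_mul {c : ℝ} (hc : 0 < Real.cos c) :
    InjOn (fun a => Real.cos c * Real.cos a) (Ioo 0 Real.pi) := by
  intro a ha b hb h
  exact Real.injOn_cos (Ioo_subset_Icc_self ha) (Ioo_subset_Icc_self hb)
    (mul_left_cancel₀ hc.ne' h)

/-- The conventions that `√` vanishes on nonpositive reals and `0⁻¹ = 0` build the cutoff into the
kernel. -/
theorem arcKernel_of_le {c X : ℝ} (hc : 0 < Real.cos c) (hX : X ∉ Ioo (-Real.cos c) (Real.cos c)) :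
    arcKernel c X = 0 := by
  have : Real.cos c ^ 2 ≤ X ^ 2 := by
    rw [sq_le_sq, abs_of_pos hc]
    by_contra! h
    exact hX (abs_lt.1 h)
  rw [arcKernel, Real.sqrt_eq_zero_of_nonpos (by linarith), inv_zero]

/-- The kernel is the reciprocal Jacobian of `a ↦ cos c cos a`. -/
theorem abs_deriv_mul_arcKernel {c a : ℝ} (hc : 0 < Real.cos c) (ha : a ∈ Ioo 0 Real.pi) :
    |Real.cos c * -Real.sin a| * arcKernel c (Real.cos c * Real.cos a) = 1 := by
  have hs := Real.sin_pos_of_mem_Ioo ha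
  rw [arcKernel, show Real.cos c ^ 2 - (Real.cos c * Real.cos a) ^ 2 = (Real.cos c * Real.sin a) ^ 2 by
    rw [mul_pow, mul_pow, Real.sin_sq]; ring, Real.sqrt_sq (by positivity), mul_neg, abs_neg,
    abs_of_pos (by positivity)]
  field_simp

section
variable {E : Type*} [NormedAddCommGroup E] [NormedSpace ℝ E]

theorem Ioo_cos_subset {c : ℝ} : Ioo (-Real.cos c) (Real.cos c) ⊆ Ioo (-1) 1 :=
  Ioo_subset_Ioo (by linarith [Real.cos_le_one c]) (Real.cos_le_one c)

theorem integrableOn_arcKernel_smul {c : ℝ} (hc : 0 < Real.cos c) {g : ℝ → E}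
    (hg : IntegrableOn (fun a => g (Real.cos c * Real.cos a)) (Ioo 0 Real.pi)) :
    IntegrableOn (fun X => arcKernel c X • g X) (Ioo (-1) 1) := by
  have h1 := (integrableOn_image_iff_integrableOn_abs_deriv_smul (s := Ioo 0 Real.pi)
    (f := fun a => Real.cos c * Real.cos a) (f' := fun a => Real.cos c * -Real.sin a)
    measurableSet_Ioo (fun a _ => ((Real.hasDerivAt_cos a).const_mul _).hasDerivWithinAt)
    (injOn_cos_mul hc) (fun X => arcKernel c X • g X)).2 ?_
  · rw [image_cos_mul hc] at h1
    refine IntegrableOn.of_forall_sdiff_eq_zero h1 measurableSet_Ioo fun X hX => ?_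
    rw [arcKernel_of_le hc hX.2, zero_smul]
  · refine hg.congr_fun (fun a ha => ?_) measurableSet_Ioo
    simp only
    rw [smul_smul, abs_deriv_mul_arcKernel hc ha, one_smul]

theorem integral_arcKernel_smul {c : ℝ} (hc : 0 < Real.cos c) (g : ℝ → E) :
    ∫ X in Ioo (-1) 1, arcKernel c X • g X
      = ∫ a in Ioo 0 Real.pi, g (Real.cos c * Real.cos a) := by
  rw [setIntegral_eq_of_subset_of_forall_sdiff_eq_zero measurableSet_Ioo Ioo_cos_subset
    (fun X hX => by rw [arcKernel_of_le hc hX.2, zero_smul]), ← image_cos_mul hc,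
    integral_image_eq_integral_abs_deriv_smul (f' := fun a => Real.cos c * -Real.sin a)
    measurableSet_Ioo (fun a _ => ((Real.hasDerivAt_cos a).const_mul _).hasDerivWithinAt)
    (injOn_cos_mul hc)]
  refine setIntegral_congr_fun measurableSet_Ioo fun a ha => ?_
  rw [smul_smul, abs_deriv_mul_arcKernel hc ha, one_smul]
end

/-- Substituting `sin c = r sin φ` with `r = √(1 - X²)`. -/
theorem integral_arcKernel_mul_eq_density (p : ℂ → ℂ) {X : ℝ} (hX : X ∈ Ioo (-1) 1) :
    ∫ c in Ioo 0 (Real.pi / 2), p (Real.sin c ^ 2) * arcKernel c X = density p X := by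
  set r : ℝ := √(1 - X ^ 2) with hr
  have hX2 : X ^ 2 < 1 := by
    have := abs_lt.2 hX
    rwa [sq_lt_one_iff_abs_lt_one]
  have hrpos : 0 < r := Real.sqrt_pos.2 (by linarith)
  have hr2 : r ^ 2 = 1 - X ^ 2 := Real.sq_sqrt (by linarith)
  have hr1 : r ≤ 1 := by
    rw [hr, Real.sqrt_le_one]; nlinarith [sq_nonneg X]
  have hpi := Real.pi_pos
  have hsin : ∀ φ ∈ Ioo 0 (Real.pi / 2), 0 < Real.sin φ ∧ Real.sin φ < 1 ∧ 0 < Real.cos φ := by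
    intro φ hφ
    have hc := Real.cos_pos_of_mem_Ioo ⟨by linarith [hφ.1], hφ.2⟩
    refine ⟨Real.sin_pos_of_mem_Ioo ⟨hφ.1, by linarith [hφ.2]⟩, ?_, hc⟩
    nlinarith [Real.sin_sq_add_cos_sq φ, Real.sin_le_one φ]
  have hrs : ∀ φ ∈ Ioo 0 (Real.pi / 2), 0 < r * Real.sin φ ∧ r * Real.sin φ < r ∧
      r * Real.sin φ < 1 := by
    intro φ hφ
    obtain ⟨h1, h2, -⟩ := hsin φ hφ
    exact ⟨by positivity, by nlinarith, by nlinarith⟩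
  have himg : (fun φ => Real.arcsin (r * Real.sin φ)) '' Ioo 0 (Real.pi / 2)
      = Ioo 0 (Real.arcsin r) := by
    ext c
    constructor
    · rintro ⟨φ, hφ, rfl⟩
      obtain ⟨h1, h2, h3⟩ := hrs φ hφ
      exact ⟨Real.arcsin_pos.2 h1, Real.strictMonoOn_arcsin ⟨by linarith, h3.le⟩
        ⟨by linarith, hr1⟩ h2⟩
    · rintro ⟨h1, h2⟩
      have hc2 : c < Real.pi / 2 := h2.trans_le (Real.arcsin_le_pi_div_two r)
      obtain ⟨h3, h4, h5⟩ := hsin c ⟨h1, hc2⟩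
      have h6 : Real.sin c < r := (Real.lt_arcsin_iff_sin_lt' ⟨by linarith, hc2⟩).1 h2
      have h7 : Real.sin c / r < 1 := (div_lt_one hrpos).2 h6
      refine ⟨Real.arcsin (Real.sin c / r), ⟨Real.arcsin_pos.2 (by positivity),
        Real.arcsin_lt_pi_div_two.2 h7⟩, ?_⟩
      simp only
      have h8 : 0 < Real.sin c / r := by positivity
      rw [Real.sin_arcsin (by linarith) h7.le, mul_div_cancel₀ _ hrpos.ne',
        Real.arcsin_sin (by linarith) hc2.le]
  have hinj : InjOn (fun φ => Real.arcsin (r * Real.sin φ)) (Ioo 0 (Real.pi / 2)) := by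
    intro a ha b hb h
    obtain ⟨h1, h2, h3⟩ := hrs a ha
    obtain ⟨h4, h5, h6⟩ := hrs b hb
    have := Real.injOn_arcsin ⟨by linarith, h3.le⟩ ⟨by linarith, h6.le⟩ h
    exact Real.injOn_sin ⟨by linarith [ha.1], ha.2.le⟩ ⟨by linarith [hb.1], hb.2.le⟩
      (mul_left_cancel₀ hrpos.ne' this)
  -- For `c ≥ arcsin r` one has `cos² c ≤ X²` and the kernel vanishes.
  have hsub : Ioo 0 (Real.arcsin r) ⊆ Ioo 0 (Real.pi / 2) :=
    Ioo_subset_Ioo_right (Real.arcsin_le_pi_div_two r)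
  rw [setIntegral_eq_of_subset_of_forall_sdiff_eq_zero measurableSet_Ioo hsub, ← himg,
    integral_image_eq_integral_abs_deriv_smul
      (f' := fun φ => 1 / √(1 - (r * Real.sin φ) ^ 2) * (r * Real.cos φ)) measurableSet_Ioo ?_ hinj]
  · refine setIntegral_congr_fun measurableSet_Ioo fun φ hφ => ?_
    obtain ⟨h1, h2, h3⟩ := hrs φ hφ
    obtain ⟨h4, h5, h6⟩ := hsin φ hφ
    have h7 : 0 < 1 - (r * Real.sin φ) ^ 2 := by nlinarith
    -- `cos² c - X² = r² cos² φ`, so the kernel cancels the factor `r cos φ` of the Jacobian.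
    have hk : arcKernel (Real.arcsin (r * Real.sin φ)) X = (r * Real.cos φ)⁻¹ := by
      rw [arcKernel, Real.cos_sq', Real.sin_arcsin (by linarith) h3.le,
        show 1 - (r * Real.sin φ) ^ 2 - X ^ 2 = (r * Real.cos φ) ^ 2 by
          rw [mul_pow, mul_pow, Real.cos_sq', hr2]; ring, Real.sqrt_sq (by positivity)]
    have hb : (1 - (1 - (X : ℂ) ^ 2) * (Real.sin φ : ℂ) ^ 2) = ((1 - (r * Real.sin φ) ^ 2 : ℝ) : ℂ) := by
      rw [mul_pow, hr2]; push_cast; ring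
    have hpw : (1 - (1 - (X : ℂ) ^ 2) * (Real.sin φ : ℂ) ^ 2) ^ (-(1 / 2) : ℂ)
        = ((√(1 - (r * Real.sin φ) ^ 2))⁻¹ : ℝ) := by
      rw [hb, Real.sqrt_eq_rpow, ← Real.rpow_neg h7.le, Complex.ofReal_cpow h7.le]
      push_cast; rfl
    have hs : 0 < √(1 - (r * Real.sin φ) ^ 2) := Real.sqrt_pos.2 h7
    have hreal : 1 / √(1 - (r * Real.sin φ) ^ 2) * (r * Real.cos φ) * (r * Real.cos φ)⁻¹
        = (√(1 - (r * Real.sin φ) ^ 2))⁻¹ := by field_simp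
    rw [hk, hpw, abs_of_pos (by positivity), Real.sin_arcsin (by linarith) h3.le, Complex.real_smul,
      show (1 - (X : ℂ) ^ 2) * (Real.sin φ : ℂ) ^ 2 = ((r * Real.sin φ : ℝ) : ℂ) ^ 2 by
        push_cast; rw [mul_pow, ← Complex.ofReal_pow r, hr2]; push_cast; ring]
    rw [← hreal]
    push_cast
    ring
  · intro φ hφ
    obtain ⟨h1, h2, h3⟩ := hrs φ hφ
    have := (Real.hasDerivAt_arcsin (x := r * Real.sin φ) (by linarith) h3.ne)
    exact (this.comp φ ((Real.hasDerivAt_sin φ).const_mul r)).hasDerivWithinAt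
  · rintro c ⟨hc, hc'⟩
    obtain ⟨h3, h4, h5⟩ := hsin c hc
    have h6 : r ≤ Real.sin c := by
      by_contra! h
      exact hc' ⟨hc.1, (Real.lt_arcsin_iff_sin_lt' ⟨by linarith [hc.1], hc.2⟩).2 h⟩
    have : arcKernel c X = 0 := by
      rw [arcKernel, Real.sqrt_eq_zero_of_nonpos, inv_zero]
      rw [Real.cos_sq']
      nlinarith
    rw [this]; simp

theorem measurable_arcKernel : Measurable (Function.uncurry arcKernel) := by
  unfold arcKernel Function.uncurry
  exact (Continuous.measurable (by fun_prop)).inv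

/-- The kernel is nonnegative, and undoing the substitution bounds its inner integral against `‖h‖`
by `M π`, uniformly in `c`. This justifies Fubini. -/
theorem integrable_arcKernel_prod {p : ℂ → ℂ} (hp : Continuous p) {h : ℝ → ℂ} (hh : Measurable h)
    {M : ℝ} (hM : ∀ x ∈ Ioo (-1) 1, ‖h x‖ ≤ M) :
    Integrable (fun q : ℝ × ℝ => (p (Real.sin q.1 ^ 2) * arcKernel q.1 q.2) * h q.2)
      ((volume.restrict (Ioo 0 (Real.pi / 2))).prod (volume.restrict (Ioo (-1) 1))) := by
  have hmeas : Measurable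
      (fun q : ℝ × ℝ => (p (Real.sin q.1 ^ 2) * arcKernel q.1 q.2) * h q.2) := by
    refine (Measurable.mul (Continuous.measurable ?_) ?_).mul (hh.comp measurable_snd)
    · fun_prop
    · exact Complex.measurable_ofReal.comp measurable_arcKernel
  have hcos : ∀ c ∈ Ioo 0 (Real.pi / 2), 0 < Real.cos c := fun c hc =>
    Real.cos_pos_of_mem_Ioo ⟨by linarith [hc.1, Real.pi_pos], hc.2⟩
  have hint : ∀ c ∈ Ioo 0 (Real.pi / 2),
      IntegrableOn (fun X => (p (Real.sin c ^ 2) * arcKernel c X) * h X) (Ioo (-1) 1) := by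
    intro c hc
    have hb : IntegrableOn (fun a => h (Real.cos c * Real.cos a)) (Ioo 0 Real.pi) := by
      refine IntegrableOn.of_bound (by simp) ?_ M ?_
      · exact (hh.comp (by fun_prop)).aestronglyMeasurable
      · filter_upwards [ae_restrict_mem measurableSet_Ioo] with a ha
        refine hM _ (Ioo_cos_subset (c := c) ?_)
        rw [← image_cos_mul (hcos c hc)]
        exact ⟨a, ha, rfl⟩
    refine IntegrableOn.congr_fun (Integrable.const_mul
      (integrableOn_arcKernel_smul (hcos c hc) hb) (p (Real.sin c ^ 2))) (fun X _ => ?_)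
      measurableSet_Ioo
    simp only [Complex.real_smul]
    ring
  rw [integrable_prod_iff hmeas.aestronglyMeasurable]
  constructor
  · filter_upwards [ae_restrict_mem measurableSet_Ioo] with c hc
    exact hint c hc
  · obtain ⟨B, hB⟩ := (isCompact_Icc (a := (0 : ℝ)) (b := Real.pi / 2)).exists_bound_of_continuousOn
      (f := fun c : ℝ => p (Real.sin c ^ 2)) (by fun_prop)
    refine Integrable.of_bound (C := B * (M * Real.pi))
      (hmeas.norm.aestronglyMeasurable.integral_prod_right') ?_
    filter_upwards [ae_restrict_mem measurableSet_Ioo] with c hc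
    have h1 : ∀ X, ‖(p (Real.sin c ^ 2) * arcKernel c X) * h X‖
        = ‖p (Real.sin c ^ 2)‖ * (arcKernel c X • ‖h X‖) := by
      intro X
      rw [norm_mul, norm_mul, Complex.norm_real, Real.norm_eq_abs, abs_of_nonneg, smul_eq_mul,
        mul_assoc]
      exact inv_nonneg.2 (Real.sqrt_nonneg _)
    simp only [h1]
    rw [integral_const_mul, integral_arcKernel_smul (hcos c hc), norm_mul, norm_norm]
    have hB' := hB c (Ioo_subset_Icc_self hc)
    have h2 : ‖∫ a in Ioo 0 Real.pi, ‖h (Real.cos c * Real.cos a)‖‖ ≤ M * volume.real (Ioo 0 Real.pi) := by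
      refine norm_setIntegral_le_of_norm_le_const (by simp) fun a ha => ?_
      rw [norm_norm]
      refine hM _ (Ioo_cos_subset (c := c) ?_)
      rw [← image_cos_mul (hcos c hc)]
      exact ⟨a, ha, rfl⟩
    rw [Real.volume_real_Ioo_of_le Real.pi_pos.le, sub_zero] at h2
    exact mul_le_mul hB' h2 (norm_nonneg _) ((norm_nonneg _).trans hB')

theorem integral_integral_eq_integral_density {p : ℂ → ℂ} (hp : Continuous p) {h : ℝ → ℂ}
    (hh : Measurable h) {M : ℝ} (hM : ∀ x ∈ Ioo (-1) 1, ‖h x‖ ≤ M) :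
    ∫ c in Ioo 0 (Real.pi / 2), ∫ a in Ioo 0 Real.pi,
        p (Real.sin c ^ 2) * h (Real.cos c * Real.cos a)
      = ∫ X in Ioo (-1) 1, density p (X : ℝ) * h X := by
  have h1 : ∫ c in Ioo 0 (Real.pi / 2), ∫ a in Ioo 0 Real.pi,
        p (Real.sin c ^ 2) * h (Real.cos c * Real.cos a)
      = ∫ c in Ioo 0 (Real.pi / 2), ∫ X in Ioo (-1) 1, (p (Real.sin c ^ 2) * arcKernel c X) * h X := by
    refine setIntegral_congr_fun measurableSet_Ioo fun c hc => ?_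
    rw [integral_const_mul, ← integral_arcKernel_smul
      (Real.cos_pos_of_mem_Ioo ⟨by linarith [hc.1, Real.pi_pos], hc.2⟩), ← integral_const_mul]
    refine integral_congr_ae (Eventually.of_forall fun X => ?_)
    simp only [Complex.real_smul]
    ring
  rw [h1, integral_integral_swap (integrable_arcKernel_prod hp hh hM)]
  refine setIntegral_congr_fun measurableSet_Ioo fun X hX => ?_
  rw [integral_mul_const, integral_arcKernel_mul_eq_density p hX]

/-- Fubini with `h = 1` gives this without a pointwise bound, which would fail near `X = 0` in
general. -/
theorem integrableOn_density {p : ℂ → ℂ} (hp : Continuous p) :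
    IntegrableOn (fun X : ℝ => density p X) (Ioo (-1) 1) := by
  have := (integrable_arcKernel_prod hp (h := fun _ => 1) measurable_const (M := 1)
    (by simp)).integral_prod_right
  refine IntegrableOn.congr_fun this (fun X hX => ?_) measurableSet_Ioo
  simp only [mul_one]
  exact integral_arcKernel_mul_eq_density p hX

/-- With `s = sin² φ`, the base of the power is the convex combination `(1 - s) + s X²`. For `Re X >
0` the point `X²` lies in the slit plane, which is star-shaped about `1`. -/
theorem differentiableOn_density {p : ℂ → ℂ} (hp : Differentiable ℂ p) :
    DifferentiableOn ℂ (density p) {X | 0 < X.re} := by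
  have hslit : ∀ X : ℂ, 0 < X.re → ∀ φ : ℝ,
      1 - (1 - X ^ 2) * (Real.sin φ : ℂ) ^ 2 ∈ Complex.slitPlane := by
    intro X hX φ
    set s : ℝ := Real.sin φ ^ 2 with hs
    have hs0 : 0 ≤ s := sq_nonneg _
    have hs1 : s ≤ 1 := Real.sin_sq_le_one φ
    have h1 : 1 - (1 - X ^ 2) * (Real.sin φ : ℂ) ^ 2 = ((1 - s : ℝ) : ℂ) + (s : ℝ) * X ^ 2 := by
      rw [hs]; push_cast; ring
    rw [h1, Complex.mem_slitPlane_iff]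
    simp only [Complex.add_re, Complex.add_im, Complex.ofReal_re, Complex.ofReal_im,
      Complex.re_ofReal_mul, Complex.im_ofReal_mul, zero_add]
    rw [sq, Complex.mul_re, Complex.mul_im]
    by_cases h : s * (X.re * X.im + X.im * X.re) = 0
    · left
      rcases mul_eq_zero.1 h with h0 | h0
      · rw [h0]; simp
      · have : X.im = 0 := by
          have h2 : X.re * X.im = 0 := by linarith
          exact (mul_eq_zero.1 h2).resolve_left hX.ne'
        rw [this]
        rcases hs0.eq_or_lt with h3 | h3
        · rw [← h3]; simp
        · have := mul_pos h3 (mul_pos hX hX)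
          nlinarith
    · right; exact h
  refine differentiableOn_setIntegral (isOpen_lt continuous_const Complex.continuous_re)
    (K := Icc 0 (Real.pi / 2)) isCompact_Icc measurableSet_Ioo Ioo_subset_Icc_self
    (F := fun X φ => p ((1 - X ^ 2) * Real.sin φ ^ 2) *
      (1 - (1 - X ^ 2) * Real.sin φ ^ 2) ^ (-(1 / 2) : ℂ)) ?_ ?_
  · refine ContinuousOn.mul ?_ ?_
    · have := hp.continuous
      exact Continuous.continuousOn (by fun_prop)
    · refine ContinuousOn.cpow_const (Continuous.continuousOn (by fun_prop)) ?_
      rintro ⟨X, φ⟩ ⟨hX, -⟩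
      exact hslit X hX φ
  · intro φ _
    refine DifferentiableOn.mul (Differentiable.differentiableOn (by fun_prop)) ?_
    intro X hX
    exact (DifferentiableAt.cpow_const (f := fun X : ℂ => 1 - (1 - X ^ 2) * (Real.sin φ : ℂ) ^ 2)
      (by fun_prop) (hslit X hX φ)).differentiableWithinAt


/-! ### The resolvent integral off `[-1, 1]` and at its endpoint. -/

/-- The real segment `[-1, 1]` in the complex plane. -/
def unitCut : Set ℂ := {e | e.im = 0 ∧ e.re ∈ Icc (-1 : ℝ) 1}

/-- The resolvent integral `∫∫ p (sin² c) / (e - cos c cos a) da dc`. -/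
noncomputable def diagTransform (p : ℂ → ℂ) (e : ℂ) : ℂ :=
  ∫ c in Ioo 0 (Real.pi / 2), ∫ a in Ioo 0 Real.pi,
    p (Real.sin c ^ 2) * (e - ((Real.cos c * Real.cos a : ℝ) : ℂ))⁻¹

theorem isOpen_compl_unitCut : IsOpen unitCutᶜ := by
  have : unitCut = (fun e : ℂ => e.im) ⁻¹' {0} ∩ (fun e : ℂ => e.re) ⁻¹' Icc (-1 : ℝ) 1 := rfl
  rw [this]
  exact ((isClosed_singleton.preimage Complex.continuous_im).inter
    (isClosed_Icc.preimage Complex.continuous_re)).isOpen_compl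

theorem sub_ofReal_ne_zero_of_notMem {e : ℂ} (he : e ∈ unitCutᶜ) {x : ℝ} (hx : x ∈ Icc (-1 : ℝ) 1) :
    e - x ≠ 0 := by
  intro h
  rw [sub_eq_zero] at h
  exact he (by rw [h]; exact ⟨Complex.ofReal_im x, by simpa using hx⟩)

theorem diagTransform_eq_integral_density {p : ℂ → ℂ} (hp : Continuous p) {e : ℂ}
    (he : e ∈ unitCutᶜ) :
    diagTransform p e = ∫ X in Ioo (-1 : ℝ) 1, density p X * (e - X)⁻¹ := by
  obtain ⟨M, hM⟩ := (isCompact_Icc (a := (-1 : ℝ)) (b := 1)).exists_bound_of_continuousOn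
    (f := fun x : ℝ => (e - (x : ℂ))⁻¹)
    (ContinuousOn.inv₀ (by fun_prop) fun x hx => sub_ofReal_ne_zero_of_notMem he hx)
  exact integral_integral_eq_integral_density hp (h := fun x : ℝ => (e - (x : ℂ))⁻¹)
    (Measurable.inv (by fun_prop)) (M := M) fun x hx => hM x (Ioo_subset_Icc_self hx)

theorem differentiableOn_diagTransform {p : ℂ → ℂ} (hp : Continuous p) :
    DifferentiableOn ℂ (diagTransform p) unitCutᶜ := by
  refine DifferentiableOn.congr ?_ (fun e he => diagTransform_eq_integral_density hp he)
  refine differentiableOn_integral_mul isOpen_compl_unitCut (K := Icc (-1 : ℝ) 1) isCompact_Icc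
    measurableSet_Ioo Ioo_subset_Icc_self (integrableOn_density hp)
    (F := fun e X => (e - (X : ℂ))⁻¹) ?_ ?_
  · refine ContinuousOn.inv₀ (Continuous.continuousOn (by fun_prop)) ?_
    rintro ⟨e, X⟩ ⟨he, hX⟩
    exact sub_ofReal_ne_zero_of_notMem he hX
  · intro X hX
    exact DifferentiableOn.inv (by fun_prop) fun e he => sub_ofReal_ne_zero_of_notMem he hX

theorem neg_mem_compl_unitCut {e : ℂ} (he : e ∈ unitCutᶜ) : -e ∈ unitCutᶜ := by
  rintro ⟨h1, h2, h3⟩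
  simp only [Complex.neg_im, Complex.neg_re, neg_eq_zero] at h1 h2 h3
  exact he ⟨h1, by linarith, by linarith⟩

/-- The density depends only on `X²`, so reflecting `X` reverses the sign. This transports the
analysis at `e = 1` to `e = -1`. -/
theorem diagTransform_neg {p : ℂ → ℂ} (hp : Continuous p) {e : ℂ} (he : e ∈ unitCutᶜ) :
    diagTransform p (-e) = -diagTransform p e := by
  rw [diagTransform_eq_integral_density hp he,
    diagTransform_eq_integral_density hp (neg_mem_compl_unitCut he),
    ← integral_Ioc_eq_integral_Ioo, ← integral_Ioc_eq_integral_Ioo,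
    ← intervalIntegral.integral_of_le (by norm_num), ← intervalIntegral.integral_of_le (by norm_num)]
  have := intervalIntegral.integral_comp_neg (a := -1) (b := 1)
    (fun X : ℝ => density p X * (e - X)⁻¹)
  rw [neg_neg] at this
  rw [← this, ← intervalIntegral.integral_neg]
  refine intervalIntegral.integral_congr fun X _ => ?_
  have h1 : density p ((-X : ℝ) : ℂ) = density p X := by simp [density]
  rw [h1, ← mul_neg, ← inv_neg]
  congr 2
  push_cast
  ring

/-- The logarithmic singularity of the resolvent integral at `e = 1`. -/
theorem exists_diagTransform_eq_log {p : ℂ → ℂ} (hp : Differentiable ℂ p) {c : ℝ} (hc0 : 0 < c)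
    (hc1 : c < 1) :
    ∃ u₁ u₂ : ℂ → ℂ, DifferentiableOn ℂ u₁ {e | c < e.re} ∧ DifferentiableOn ℂ u₂ {e | c < e.re} ∧
      ∀ e : ℂ, c < e.re → e - 1 ∈ Complex.slitPlane →
        diagTransform p e = u₁ e * Complex.log (e - 1) + u₂ e := by
  have hsub : {e : ℂ | c < e.re} ⊆ {e : ℂ | 0 < e.re} := fun e he => hc0.trans he
  have hopen : IsOpen {e : ℂ | c < e.re} := isOpen_lt continuous_const Complex.continuous_re
  obtain ⟨u, hu, hueq⟩ := exists_cauchyTransform_eq_log hc1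
    (isOpen_lt continuous_const Complex.continuous_re) (convex_halfSpace_re_gt 0)
    (fun x hx => by simpa using hc0.trans_le hx.1) (differentiableOn_density hp)
  have hne : ∀ e : ℂ, c < e.re → ∀ x ∈ Icc (-1 : ℝ) c, e - (x : ℂ) ≠ 0 := by
    intro e he x hx h
    rw [sub_eq_zero] at h
    rw [h, Complex.ofReal_re] at he
    linarith [hx.2]
  have hIoc : IntegrableOn (fun X : ℝ => density p X) (Ioc (-1) c) :=
    (integrableOn_density hp.continuous).mono_set
      (fun x hx => ⟨hx.1, hx.2.trans_lt hc1⟩)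
  -- Cutting at `c > 0` leaves the possible blow-up of the density at `X = 0` in a part where `e -
  -- X` cannot vanish.
  refine ⟨fun e => -density p e, fun e => (∫ X in Ioc (-1 : ℝ) c, density p X * (e - X)⁻¹) + u e,
    ((differentiableOn_density hp).mono hsub).neg, DifferentiableOn.add ?_ ?_, ?_⟩
  · refine differentiableOn_integral_mul hopen (K := Icc (-1 : ℝ) c) isCompact_Icc
      measurableSet_Ioc Ioc_subset_Icc_self hIoc (F := fun e X => (e - (X : ℂ))⁻¹) ?_ ?_
    · refine ContinuousOn.inv₀ (Continuous.continuousOn (by fun_prop)) ?_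
      rintro ⟨e, X⟩ ⟨he, hX⟩
      exact hne e he X hX
    · intro X hX
      exact DifferentiableOn.inv (by fun_prop) fun e he => hne e he X hX
  · exact hu.mono fun e he => ⟨hsub he, he⟩
  · intro e he hslit
    have heI : e ∈ unitCutᶜ := by
      rintro ⟨h1, h2, h3⟩
      rw [Complex.mem_slitPlane_iff] at hslit
      simp only [Complex.sub_re, Complex.one_re, Complex.sub_im, Complex.one_im, sub_zero] at hslit
      rcases hslit with h | h
      · linarith
      · exact h h1
    have hcont : ∀ a b : ℝ, Ioc a b ⊆ Ioc (-1) 1 →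
        IntegrableOn (fun X : ℝ => density p X * (e - X)⁻¹) (Ioc a b) := by
      intro a b hab
      have h1 : IntegrableOn (fun X : ℝ => density p X * (e - X)⁻¹) (Ioc (-1) 1) := by
        have hd : IntegrableOn (fun X : ℝ => density p X) (Ioc (-1) 1) := by
          rw [integrableOn_Ioc_iff_integrableOn_Ioo]
          exact integrableOn_density hp.continuous
        have hcn : ContinuousOn (fun x : ℝ => (e - (x : ℂ))⁻¹) (Icc (-1) 1) :=
          ContinuousOn.inv₀ (by fun_prop) fun x hx => sub_ofReal_ne_zero_of_notMem heI hx
        obtain ⟨M, hM⟩ := isCompact_Icc.exists_bound_of_continuousOn hcn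
        refine Integrable.mul_bdd (c := M) hd
          ((hcn.mono Ioc_subset_Icc_self).aestronglyMeasurable measurableSet_Ioc) ?_
        filter_upwards [ae_restrict_mem measurableSet_Ioc] with x hx
        exact hM x (Ioc_subset_Icc_self hx)
      exact h1.mono_set hab
    rw [diagTransform_eq_integral_density hp.continuous heI, ← integral_Ioc_eq_integral_Ioo,
      ← Ioc_union_Ioc_eq_Ioc (show (-1 : ℝ) ≤ c by linarith) hc1.le,
      setIntegral_union (Ioc_disjoint_Ioc_of_le le_rfl) measurableSet_Ioc
        (hcont _ _ (Ioc_subset_Ioc_right hc1.le)) (hcont _ _ (Ioc_subset_Ioc_left (by linarith))),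
      hueq e ⟨hsub he, he⟩ hslit]
    ring

/-! ### The imaginary modulus transformation. -/

/-- The principal value of `√(1 - e²)`. -/
noncomputable def conjParam (e : ℂ) : ℂ := (1 - e ^ 2) ^ (2⁻¹ : ℂ)

theorem conjParam_sq (e : ℂ) : conjParam e ^ 2 = 1 - e ^ 2 := by
  simpa only [conjParam, Nat.cast_ofNat] using Complex.cpow_nat_inv_pow (1 - e ^ 2) two_ne_zero

theorem conjParam_neg (e : ℂ) : conjParam (-e) = conjParam e := by
  simp [conjParam]

theorem im_eq_zero_of_sq {e : ℂ} {t : ℝ} (ht : 0 ≤ t) (h : e ^ 2 = t) : e.im = 0 := by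
  have h1 := congrArg Complex.re h
  have h2 := congrArg Complex.im h
  rw [sq] at h1 h2
  simp only [Complex.mul_re, Complex.mul_im, Complex.ofReal_re, Complex.ofReal_im] at h1 h2
  by_contra hi
  have h3 : e.re = 0 := by
    have : e.re * e.im = 0 := by linarith
    exact (mul_eq_zero.1 this).resolve_right hi
  rw [h3] at h1
  have := mul_self_pos.2 hi
  linarith

theorem conjParam_mem_compl_unitCut {e : ℂ} (he : e.im ≠ 0) : conjParam e ∈ unitCutᶜ := by
  rintro ⟨h1, h2, h3⟩
  set m := conjParam e with hm
  have hm' : m = (m.re : ℂ) := Complex.ext rfl (by simpa using h1)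
  refine he (im_eq_zero_of_sq (t := 1 - m.re ^ 2) (by nlinarith) ?_)
  push_cast
  rw [← hm', hm, conjParam_sq]
  ring

theorem one_sub_sq_mem_slitPlane {e : ℂ} (he : e.im ≠ 0) : 1 - e ^ 2 ∈ Complex.slitPlane := by
  rw [Complex.mem_slitPlane_iff_not_le_zero, Complex.le_def]
  rintro ⟨h1, h2⟩
  simp only [Complex.sub_re, Complex.sub_im, Complex.one_re, Complex.one_im, Complex.zero_re,
    Complex.zero_im] at h1 h2
  refine he (im_eq_zero_of_sq (t := (e ^ 2).re) (by linarith) ?_)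
  exact Complex.ext rfl (by simp; linarith)

theorem differentiableAt_conjParam {e : ℂ} (he : 1 - e ^ 2 ∈ Complex.slitPlane) :
    DifferentiableAt ℂ conjParam e :=
  DifferentiableAt.cpow_const (f := fun e : ℂ => 1 - e ^ 2) (by fun_prop) he

/-- Here both inner integrals are elementary: `i π / √(y² + cos² c)` on the left, `π / √(y² + sin²
c)` on the right. The reflection `c ↦ π/2 - c` exchanges them and turns `p z` into `p (1 - z)`. -/
theorem diagTransform_neg_I_mul {p : ℂ → ℂ} {y : ℝ} (hy : 0 < y) :
    diagTransform p (-Complex.I * y)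
      = Complex.I * diagTransform (fun z => p (1 - z)) (conjParam (-Complex.I * y)) := by
  have hconj : conjParam (-Complex.I * y) = (√(1 + y ^ 2) : ℝ) := by
    rw [conjParam, show 1 - (-Complex.I * y) ^ 2 = ((1 + y ^ 2 : ℝ) : ℂ) by
      push_cast; linear_combination -(y : ℂ) ^ 2 * Complex.I_sq, Real.sqrt_eq_rpow,
      Complex.ofReal_cpow (by positivity)]
    norm_num
  have hsq : √(1 + y ^ 2) ^ 2 = 1 + y ^ 2 := Real.sq_sqrt (by positivity)
  have hgt : 1 < √(1 + y ^ 2) := by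
    rw [Real.lt_sqrt (by norm_num)]; nlinarith
  have hL : diagTransform p (-Complex.I * y) = ∫ c in (0 : ℝ)..(Real.pi / 2),
      p (Real.sin c ^ 2) * (Complex.I * ((Real.pi / √(y ^ 2 + Real.cos c ^ 2) : ℝ) : ℂ)) := by
    rw [diagTransform, intervalIntegral.integral_of_le (by positivity), integral_Ioc_eq_integral_Ioo]
    refine setIntegral_congr_fun measurableSet_Ioo fun c _ => ?_
    rw [integral_const_mul, ← integral_inv_neg_I_mul_sub hy,
      intervalIntegral.integral_of_le Real.pi_pos.le, integral_Ioc_eq_integral_Ioo]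
    simp only [Complex.ofReal_mul]
  have hR : diagTransform (fun z => p (1 - z)) (conjParam (-Complex.I * y))
      = ∫ c in (0 : ℝ)..(Real.pi / 2),
      p (1 - Real.sin c ^ 2) * ((Real.pi / √(y ^ 2 + Real.sin c ^ 2) : ℝ) : ℂ) := by
    rw [diagTransform, intervalIntegral.integral_of_le (by positivity), integral_Ioc_eq_integral_Ioo]
    refine setIntegral_congr_fun measurableSet_Ioo fun c _ => ?_
    rw [integral_const_mul, show y ^ 2 + Real.sin c ^ 2 = √(1 + y ^ 2) ^ 2 - Real.cos c ^ 2 by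
      rw [hsq, Real.sin_sq]; ring,
      ← integral_inv_ofReal_sub (by linarith [Real.cos_le_one c]) (by linarith [Real.neg_one_le_cos c]),
      intervalIntegral.integral_of_le Real.pi_pos.le, integral_Ioc_eq_integral_Ioo, hconj]
    simp only [Complex.ofReal_mul]
  have hsub := intervalIntegral.integral_comp_sub_left (a := 0) (b := Real.pi / 2)
    (fun c : ℝ => p (1 - Real.sin c ^ 2) * ((Real.pi / √(y ^ 2 + Real.sin c ^ 2) : ℝ) : ℂ))
    (Real.pi / 2)
  rw [sub_self, sub_zero] at hsub
  rw [hL, hR, ← hsub, ← intervalIntegral.integral_const_mul]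
  refine intervalIntegral.integral_congr fun c _ => ?_
  simp only [Real.sin_pi_div_two_sub]
  rw [show (1 : ℂ) - (Real.cos c : ℂ) ^ 2 = (Real.sin c : ℂ) ^ 2 by
    rw [← Complex.ofReal_pow, ← Complex.ofReal_pow, Real.sin_sq]; push_cast; ring]
  ring

/-- The imaginary modulus transformation. -/
theorem diagTransform_eq_conjParam {p : ℂ → ℂ} (hp : Continuous p) {e : ℂ} (he : e.im < 0) :
    diagTransform p e = Complex.I * diagTransform (fun z => p (1 - z)) (conjParam e) := by
  have hL : IsOpen {e : ℂ | e.im < 0} := isOpen_lt Complex.continuous_im continuous_const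
  have hsub : {e : ℂ | e.im < 0} ⊆ unitCutᶜ := fun e he h => (ne_of_lt he) h.1
  have h1 : AnalyticOnNhd ℂ (diagTransform p) {e : ℂ | e.im < 0} :=
    ((differentiableOn_diagTransform hp).mono hsub).analyticOnNhd hL
  have h2 : AnalyticOnNhd ℂ
      (fun e => Complex.I * diagTransform (fun z => p (1 - z)) (conjParam e)) {e : ℂ | e.im < 0} := by
    refine DifferentiableOn.analyticOnNhd (DifferentiableOn.const_mul ?_ _) hL
    refine DifferentiableOn.comp (g := diagTransform fun z => p (1 - z)) (t := unitCutᶜ)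
      (differentiableOn_diagTransform (by fun_prop)) ?_
      fun e he => conjParam_mem_compl_unitCut (ne_of_lt he)
    exact fun e he => (differentiableAt_conjParam
      (one_sub_sq_mem_slitPlane (ne_of_lt he))).differentiableWithinAt
  -- Identity theorem in the lower half plane: the two sides agree at the points `-i y`, which
  -- accumulate at `-i`.
  refine h1.eqOn_of_preconnected_of_frequently_eq h2 (convex_halfSpace_im_lt 0).isPreconnected
    (z₀ := -Complex.I * (1 : ℝ)) (by simp) ?_ he
  have ht : Tendsto (fun y : ℝ => -Complex.I * (y : ℂ)) (𝓝[≠] 1) (𝓝[≠] (-Complex.I * (1 : ℝ))) := by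
    refine tendsto_nhdsWithin_of_tendsto_nhds_of_eventually_within _ ?_ ?_
    · exact (Continuous.tendsto (by fun_prop) 1).mono_left nhdsWithin_le_nhds
    · filter_upwards [self_mem_nhdsWithin] with y hy h
      exact hy (by simpa using h)
  refine ht.frequently (Eventually.frequently ?_)
  filter_upwards [nhdsWithin_le_nhds (Ioi_mem_nhds (zero_lt_one' ℝ))] with y hy
  exact diagTransform_neg_I_mul hy


/-! ### Local behaviour in `k` at each real point. -/

/-- The open upper half plane. -/
def openUpper : Set ℂ := {k | 0 < k.im}

theorem isOpen_openUpper : IsOpen openUpper := isOpen_lt continuous_const Complex.continuous_im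

/-- Along the upper half plane near the real point `x`, the function `g` is a combination of
`log (k - x)` and `1` with analytic coefficients; away from the branch points there is no
logarithm. -/
def HasLogSingularity (g : ℂ → ℂ) (x : ℝ) : Prop :=
  ∃ u₁ u₂ : ℂ → ℂ, AnalyticAt ℂ u₁ x ∧ AnalyticAt ℂ u₂ x ∧ ((x : ℂ) ∉ branchPoints → u₁ = 0) ∧
    ∀ᶠ k in 𝓝[openUpper] (x : ℂ), g k = u₁ k * logBranch (k - x) + u₂ k

/-- `log (m - 1)` is `N log (k - x)` plus an analytic function, so the order `N` of the zero of `m -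
1` multiplies the logarithmic coefficient. For `N = 0` that coefficient vanishes identically, even
if `m x - 1` lies on the cut of the principal logarithm. -/
theorem hasLogSingularity_of_comp {g m q h₁ h₂ : ℂ → ℂ} {x : ℝ} {N : ℕ}
    (hm : AnalyticAt ℂ m x) (h₁m : AnalyticAt ℂ h₁ (m x)) (h₂m : AnalyticAt ℂ h₂ (m x))
    (hq : AnalyticAt ℂ q x) (hq0 : q x ≠ 0) (hN : (x : ℂ) ∉ branchPoints → N = 0)
    (hmq : ∀ᶠ k in 𝓝[openUpper] (x : ℂ), m k - 1 = (k - x) ^ N * q k)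
    (hslit : ∀ᶠ k in 𝓝[openUpper] (x : ℂ), m k - 1 ∈ Complex.slitPlane)
    (hg : ∀ᶠ k in 𝓝[openUpper] (x : ℂ), g k = h₁ (m k) * Complex.log (m k - 1) + h₂ (m k)) :
    HasLogSingularity g x := by
  obtain ⟨v, hv, hlog⟩ := exists_log_eq_logBranch (P := fun k => m k - 1) hq hq0 hmq hslit
  have h1 : AnalyticAt ℂ (fun k => h₁ (m k)) x := h₁m.comp hm
  have h2 : AnalyticAt ℂ (fun k => h₂ (m k)) x := h₂m.comp hm
  refine ⟨fun k => h₁ (m k) * N, fun k => h₁ (m k) * v k + h₂ (m k), h1.mul analyticAt_const,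
    (h1.mul hv).add h2, fun hx => ?_, ?_⟩
  · funext k; simp [hN hx]
  · filter_upwards [hg, hlog] with k hk hl
    rw [hk, hl]; ring

theorem neg_sq_div_mem_slitPlane {k : ℂ} (hk : k ∈ openUpper) :
    1 - k ^ 2 / 4 - 1 ∈ Complex.slitPlane := by
  have h : 1 - k ^ 2 / 4 - 1 = ((-(k.re * k.re - k.im * k.im) / 4 : ℝ) : ℂ)
      + ((-(k.re * k.im + k.im * k.re) / 4 : ℝ) : ℂ) * Complex.I := by
    conv_lhs => rw [← Complex.re_add_im k]
    push_cast
    linear_combination -(k.im : ℂ) ^ 2 / 4 * Complex.I_sq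
  have hk' : 0 < k.im := hk
  rw [h, Complex.mem_slitPlane_iff]
  simp only [Complex.add_re, Complex.add_im, Complex.ofReal_re, Complex.ofReal_im, Complex.mul_re,
    Complex.mul_im, Complex.I_re, Complex.I_im]
  by_cases hr : k.re = 0
  · left
    rw [hr]; nlinarith
  · right
    have : k.re * k.im ≠ 0 := mul_ne_zero hr hk'.ne'
    intro h0
    apply this
    linarith

theorem im_one_sub_sq_div (k : ℂ) : (1 - k ^ 2 / 4).im = -(k.re * k.im) / 2 := by
  have h : 1 - k ^ 2 / 4 = ((1 - (k.re * k.re - k.im * k.im) / 4 : ℝ) : ℂ)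
      + ((-(k.re * k.im) / 2 : ℝ) : ℂ) * Complex.I := by
    conv_lhs => rw [← Complex.re_add_im k]
    push_cast
    linear_combination -(k.im : ℂ) ^ 2 / 4 * Complex.I_sq
  rw [h]; simp

theorem sqrt_eight_sq : (√8 : ℝ) ^ 2 = 8 := Real.sq_sqrt (by norm_num)

theorem mem_branchPoints_of_sq {x : ℝ} (h : x = 0 ∨ x ^ 2 = 4 ∨ x ^ 2 = 8) :
    (x : ℂ) ∈ branchPoints := by
  simp only [branchPoints, mem_insert_iff, mem_singleton_iff]
  rcases h with rfl | h | h
  · simp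
  · rcases sq_eq_sq_iff_eq_or_eq_neg.1 (h.trans (by norm_num : (4 : ℝ) = 2 ^ 2)) with rfl | rfl <;>
      simp
  · rcases sq_eq_sq_iff_eq_or_eq_neg.1 (h.trans sqrt_eight_sq.symm) with rfl | rfl <;> simp

theorem analyticAt_one_sub_sq_div (z : ℂ) : AnalyticAt ℂ (fun k : ℂ => 1 - k ^ 2 / 4) z := by
  simp only [div_eq_mul_inv]
  fun_prop

theorem analyticAt_of_re_gt {f : ℂ → ℂ} {c : ℝ} (hf : DifferentiableOn ℂ f {e | c < e.re}) {e : ℂ}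
    (he : c < e.re) : AnalyticAt ℂ f e :=
  hf.analyticAt ((isOpen_lt continuous_const Complex.continuous_re).mem_nhds he)

theorem eventually_re_ne_zero {x : ℝ} (hx : x ≠ 0) :
    ∀ᶠ k : ℂ in 𝓝[openUpper] (x : ℂ), k.re ≠ 0 :=
  nhdsWithin_le_nhds (Complex.continuous_re.continuousAt.eventually_ne (by simpa using hx))

theorem eventually_lt_re {m : ℂ → ℂ} {x : ℝ} {c : ℝ} (hm : ContinuousAt m x) (hc : c < (m x).re) :
    ∀ᶠ k : ℂ in 𝓝[openUpper] (x : ℂ), c < (m k).re :=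
  nhdsWithin_le_nhds ((Complex.continuous_re.continuousAt.comp hm).eventually_const_lt hc)

/-- Here `e` is near a point of `(0, 1]`, so the endpoint formula applies with `m = e`. At `x = 0`,
`m - 1 = -k²/4` gives `N = 2`. -/
theorem hasLogSingularity_of_sq_lt_four {p : ℂ → ℂ} (hp : Differentiable ℂ p) {x : ℝ}
    (hx : x ^ 2 < 4) : HasLogSingularity (fun k => diagTransform p (1 - k ^ 2 / 4)) x := by
  have hxre : ((fun k : ℂ => 1 - k ^ 2 / 4) x).re = 1 - x ^ 2 / 4 := by
    simp only
    rw [show 1 - (x : ℂ) ^ 2 / 4 = ((1 - x ^ 2 / 4 : ℝ) : ℂ) by push_cast; ring, Complex.ofReal_re]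
  have hx0 := sq_nonneg x
  obtain ⟨u₁, u₂, hu₁, hu₂, heq⟩ := exists_diagTransform_eq_log hp
    (c := (1 - x ^ 2 / 4) / 2) (by linarith) (by linarith)
  have hc : (1 - x ^ 2 / 4) / 2 < ((fun k : ℂ => 1 - k ^ 2 / 4) x).re := by rw [hxre]; linarith
  have hg : ∀ᶠ k in 𝓝[openUpper] (x : ℂ), diagTransform p (1 - k ^ 2 / 4)
      = u₁ (1 - k ^ 2 / 4) * Complex.log (1 - k ^ 2 / 4 - 1) + u₂ (1 - k ^ 2 / 4) := by
    filter_upwards [eventually_lt_re (analyticAt_one_sub_sq_div x).continuousAt hc,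
      self_mem_nhdsWithin] with k hk hkU
    exact heq _ hk (neg_sq_div_mem_slitPlane hkU)
  have hs : ∀ᶠ k in 𝓝[openUpper] (x : ℂ), 1 - k ^ 2 / 4 - 1 ∈ Complex.slitPlane := by
    filter_upwards [self_mem_nhdsWithin] with k hkU using neg_sq_div_mem_slitPlane hkU
  by_cases h0 : x = 0
  · exact hasLogSingularity_of_comp (N := 2) (q := fun _ => -1 / 4) (analyticAt_one_sub_sq_div x)
      (analyticAt_of_re_gt hu₁ hc) (analyticAt_of_re_gt hu₂ hc) analyticAt_const (by norm_num)
      (fun h => absurd (mem_branchPoints_of_sq (Or.inl h0)) h)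
      (Eventually.of_forall fun k => by rw [h0]; push_cast; ring) hs hg
  · have hxc : (x : ℂ) ≠ 0 := by exact_mod_cast h0
    exact hasLogSingularity_of_comp (N := 0) (q := fun k => 1 - k ^ 2 / 4 - 1)
      (analyticAt_one_sub_sq_div x)
      (analyticAt_of_re_gt hu₁ hc) (analyticAt_of_re_gt hu₂ hc)
      ((analyticAt_one_sub_sq_div x).sub analyticAt_const)
      (by simp [hxc])
      (fun h => rfl)
      (Eventually.of_forall fun k => by ring) hs hg

/-- Here `e` is near a point of `[-1, 0)`; oddness allows `m = -e`. The zero of `m - 1` at `±√8` is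
simple. -/
theorem hasLogSingularity_of_four_lt_sq {p : ℂ → ℂ} (hp : Differentiable ℂ p) {x : ℝ}
    (hx : 4 < x ^ 2) (hx' : x ^ 2 ≤ 8) :
    HasLogSingularity (fun k => diagTransform p (1 - k ^ 2 / 4)) x := by
  set m : ℂ → ℂ := fun k => -(1 - k ^ 2 / 4) with hmdef
  have hm : AnalyticAt ℂ m x := (analyticAt_one_sub_sq_div x).neg
  have hxre : (m x).re = x ^ 2 / 4 - 1 := by
    simp only [hmdef]
    rw [show -(1 - (x : ℂ) ^ 2 / 4) = ((x ^ 2 / 4 - 1 : ℝ) : ℂ) by push_cast; ring,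
      Complex.ofReal_re]
  have hx0 : x ≠ 0 := by rintro rfl; norm_num at hx
  have hxc : (x : ℂ) ≠ 0 := by exact_mod_cast hx0
  obtain ⟨u₁, u₂, hu₁, hu₂, heq⟩ := exists_diagTransform_eq_log hp
    (c := (x ^ 2 / 4 - 1) / 2) (by linarith) (by linarith)
  have hc : (x ^ 2 / 4 - 1) / 2 < (m x).re := by rw [hxre]; linarith
  have him : ∀ᶠ k in 𝓝[openUpper] (x : ℂ), (1 - k ^ 2 / 4).im ≠ 0 := by
    filter_upwards [eventually_re_ne_zero hx0, self_mem_nhdsWithin] with k hk hkU h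
    rw [im_one_sub_sq_div] at h
    exact mul_ne_zero hk (ne_of_gt hkU) (by linarith)
  have hs : ∀ᶠ k in 𝓝[openUpper] (x : ℂ), m k - 1 ∈ Complex.slitPlane := by
    filter_upwards [him] with k hk
    right
    simpa [hmdef] using hk
  have hg : ∀ᶠ k in 𝓝[openUpper] (x : ℂ), diagTransform p (1 - k ^ 2 / 4)
      = (-u₁) (m k) * Complex.log (m k - 1) + (-u₂) (m k) := by
    filter_upwards [eventually_lt_re hm.continuousAt hc, hs, him] with k hk hks hki
    have h := heq _ hk hks
    rw [← neg_neg (1 - k ^ 2 / 4), diagTransform_neg hp.continuous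
      (neg_mem_compl_unitCut fun h => hki h.1)]
    change -diagTransform p (m k) = _
    rw [h, Pi.neg_apply, Pi.neg_apply]
    ring
  have hu₁' := (analyticAt_of_re_gt hu₁ hc).neg
  have hu₂' := (analyticAt_of_re_gt hu₂ hc).neg
  rcases hx'.eq_or_lt with h8 | h8
  · refine hasLogSingularity_of_comp (N := 1) (q := fun k => (k + x) * 4⁻¹) hm hu₁' hu₂'
      (by fun_prop) ?_ (fun h => absurd (mem_branchPoints_of_sq (Or.inr (Or.inr h8))) h)
      (Eventually.of_forall fun k => ?_) hs hg
    · simp [hxc]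
    · have h8c : (x : ℂ) ^ 2 = 8 := by exact_mod_cast h8
      simp only [hmdef]
      linear_combination h8c / 4
  · refine hasLogSingularity_of_comp (N := 0) (q := fun k => m k - 1) hm hu₁' hu₂'
      (hm.sub analyticAt_const) (fun h => ?_) (fun h => rfl)
      (Eventually.of_forall fun k => by ring) hs hg
    have := congrArg Complex.re h
    rw [Complex.sub_re, hxre] at this
    simp at this
    linarith

/-- Here `e` is near `0`, and `m = √(1 - e²)` is near `1`. -/
theorem hasLogSingularity_of_sq_eq_four {p : ℂ → ℂ} (hp : Differentiable ℂ p) {x : ℝ}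
    (hx : x ^ 2 = 4) : HasLogSingularity (fun k => diagTransform p (1 - k ^ 2 / 4)) x := by
  have hx0 : x ≠ 0 := by rintro rfl; norm_num at hx
  have hxc : (x : ℂ) ≠ 0 := by exact_mod_cast hx0
  have hx4 : (x : ℂ) ^ 2 = 4 := by exact_mod_cast hx
  set m : ℂ → ℂ := fun k => conjParam (1 - k ^ 2 / 4) with hmdef
  have hmx : m x = 1 := by simp [hmdef, conjParam, hx4]
  have hm : AnalyticAt ℂ m x := by
    refine AnalyticAt.cpow ?_ analyticAt_const ?_
    · exact analyticAt_const.sub ((analyticAt_one_sub_sq_div x).pow 2)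
    · simp [hx4]
  obtain ⟨u₁, u₂, hu₁, hu₂, heq⟩ := exists_diagTransform_eq_log
    (p := fun z => p (1 - z)) (by fun_prop) (c := 1 / 2) (by norm_num) (by norm_num)
  have hc : 1 / 2 < (m x).re := by rw [hmx]; norm_num
  have him : ∀ᶠ k in 𝓝[openUpper] (x : ℂ), (1 - k ^ 2 / 4).im ≠ 0 := by
    filter_upwards [eventually_re_ne_zero hx0, self_mem_nhdsWithin] with k hk hkU h
    rw [im_one_sub_sq_div] at h
    exact mul_ne_zero hk (ne_of_gt hkU) (by linarith)
  have hre := eventually_lt_re hm.continuousAt hc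
  have hs : ∀ᶠ k in 𝓝[openUpper] (x : ℂ), m k - 1 ∈ Complex.slitPlane := by
    filter_upwards [him, hre] with k hk hkr
    rw [Complex.mem_slitPlane_iff]
    by_contra! h
    simp only [Complex.sub_re, Complex.one_re, Complex.sub_im, Complex.one_im, sub_zero] at h
    exact conjParam_mem_compl_unitCut hk ⟨h.2, by linarith [h.1], by linarith [h.1]⟩
  -- In the upper half plane `Im e` has the sign opposite to `Re k`. For `x > 0` the transformation
  -- applies to `e`; for `x < 0` it applies to `-e`, and oddness changes `i` into `-i`.
  obtain ⟨κ, hκ⟩ : ∃ κ : ℂ, ∀ᶠ k in 𝓝[openUpper] (x : ℂ), diagTransform p (1 - k ^ 2 / 4)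
      = κ * diagTransform (fun z => p (1 - z)) (m k) := by
    rcases lt_or_gt_of_ne hx0 with hneg | hpos
    · refine ⟨-Complex.I, ?_⟩
      have h1 : ∀ᶠ k : ℂ in 𝓝[openUpper] (x : ℂ), k.re < 0 :=
        nhdsWithin_le_nhds (Complex.continuous_re.continuousAt.eventually_lt_const
          (by simpa using hneg))
      filter_upwards [h1, self_mem_nhdsWithin] with k hk hkU
      have hi : 0 < (1 - k ^ 2 / 4).im := by
        rw [im_one_sub_sq_div]
        have := mul_neg_of_neg_of_pos hk hkU
        linarith
      have h2 := diagTransform_eq_conjParam hp.continuous (e := -(1 - k ^ 2 / 4))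
        (by rw [Complex.neg_im]; linarith)
      rw [diagTransform_neg hp.continuous (fun h => hi.ne' h.1), conjParam_neg] at h2
      simp only [hmdef]
      linear_combination -h2
    · refine ⟨Complex.I, ?_⟩
      have h1 : ∀ᶠ k : ℂ in 𝓝[openUpper] (x : ℂ), 0 < k.re :=
        nhdsWithin_le_nhds (Complex.continuous_re.continuousAt.eventually_const_lt
          (by simpa using hpos))
      filter_upwards [h1, self_mem_nhdsWithin] with k hk hkU
      refine diagTransform_eq_conjParam hp.continuous ?_
      rw [im_one_sub_sq_div]
      have := mul_pos hk hkU
      linarith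
  have hg : ∀ᶠ k in 𝓝[openUpper] (x : ℂ), diagTransform p (1 - k ^ 2 / 4)
      = (fun z => κ * u₁ z) (m k) * Complex.log (m k - 1) + (fun z => κ * u₂ z) (m k) := by
    filter_upwards [hκ, hre, hs] with k h1 h2 h3
    rw [h1, heq _ h2 h3]
    ring
  have hm1 : m x + 1 ≠ 0 := by rw [hmx]; norm_num
  -- From `m² - 1 = -e²` and `e² = (k - x)² (k + x)² / 16`, division by `m + 1` gives `q`.
  refine hasLogSingularity_of_comp (N := 2) (q := fun k => -((k + x) ^ 2 * 16⁻¹) / (m k + 1)) hm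
    (analyticAt_const.mul (analyticAt_of_re_gt hu₁ hc))
    (analyticAt_const.mul (analyticAt_of_re_gt hu₂ hc))
    (AnalyticAt.div (by fun_prop) (hm.add analyticAt_const) hm1) ?_
    (fun h => absurd (mem_branchPoints_of_sq (Or.inr (Or.inl hx))) h) ?_ hs hg
  · refine div_ne_zero ?_ hm1
    simp [hxc]
  · filter_upwards [hre] with k hk
    have hne : m k + 1 ≠ 0 := by
      intro h
      have := congrArg Complex.re h
      simp at this
      linarith
    have hsq : m k ^ 2 = 1 - (1 - k ^ 2 / 4) ^ 2 := conjParam_sq _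
    have h16 : (16 : ℂ)⁻¹ = 1 / 16 := by norm_num
    rw [mul_div_assoc', eq_div_iff hne, h16]
    linear_combination hsq + (1 / 16) * (2 * k ^ 2 - (x : ℂ) ^ 2 - 4) * -hx4

theorem hasLogSingularity_diagTransform {p : ℂ → ℂ} (hp : Differentiable ℂ p) (x : ℝ) :
    HasLogSingularity (fun k => diagTransform p (1 - k ^ 2 / 4)) x := by
  rcases lt_trichotomy (x ^ 2) 4 with h | h | h
  · exact hasLogSingularity_of_sq_lt_four hp h
  · exact hasLogSingularity_of_sq_eq_four hp h
  · rcases le_or_gt (x ^ 2) 8 with h8 | h8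
    · exact hasLogSingularity_of_four_lt_sq hp h h8
    · refine ⟨0, fun k => diagTransform p (1 - k ^ 2 / 4), analyticAt_const, ?_, fun _ => rfl,
        Eventually.of_forall fun k => by simp⟩
      refine AnalyticAt.comp (g := diagTransform p) (f := fun k : ℂ => 1 - k ^ 2 / 4) ?_
        (analyticAt_one_sub_sq_div x)
      refine (differentiableOn_diagTransform hp.continuous).analyticAt
        (isOpen_compl_unitCut.mem_nhds fun h1 => ?_)
      have h2 := h1.2.1
      rw [show 1 - (x : ℂ) ^ 2 / 4 = ((1 - x ^ 2 / 4 : ℝ) : ℂ) by push_cast; ring,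
        Complex.ofReal_re] at h2
      linarith

/-! ### Closure properties and gluing of the local representations. -/

/-- `g`, given on the closed upper half plane off the cut, extends analytically to the closed upper
half plane off the branch points, with logarithmic singularities there. -/
def HasLogExtension (g : ℂ → ℂ) : Prop :=
  ∃ F : ℂ → ℂ,
    (∀ k ∈ closedUpper \ cut, F k = g k) ∧
    AnalyticOnNhd ℂ F (closedUpper \ branchPoints) ∧
    ∀ s ∈ branchPoints, ∃ u₁ u₂ : ℂ → ℂ,
      AnalyticAt ℂ u₁ s ∧ AnalyticAt ℂ u₂ s ∧
      ∀ᶠ k in 𝓝[slitPlaneAt s] s, F k = u₁ k * logBranch (k - s) + u₂ k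

theorem HasLogExtension.congr {f g : ℂ → ℂ} (hf : HasLogExtension f)
    (h : ∀ k ∈ closedUpper \ cut, f k = g k) : HasLogExtension g := by
  obtain ⟨F, h1, h2, h3⟩ := hf
  exact ⟨F, fun k hk => (h1 k hk).trans (h k hk), h2, h3⟩

theorem HasLogExtension.add {f g : ℂ → ℂ} (hf : HasLogExtension f) (hg : HasLogExtension g) :
    HasLogExtension (fun k => f k + g k) := by
  obtain ⟨F, h1, h2, h3⟩ := hf
  obtain ⟨G, k1, k2, k3⟩ := hg
  refine ⟨fun k => F k + G k, fun k hk => congrArg₂ (· + ·) (h1 k hk) (k1 k hk),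
    fun k hk => (h2 k hk).add (k2 k hk), fun s hs => ?_⟩
  obtain ⟨u₁, u₂, hu₁, hu₂, hu⟩ := h3 s hs
  obtain ⟨v₁, v₂, hv₁, hv₂, hv⟩ := k3 s hs
  refine ⟨fun k => u₁ k + v₁ k, fun k => u₂ k + v₂ k, hu₁.add hv₁, hu₂.add hv₂, ?_⟩
  filter_upwards [hu, hv] with k h h'
  rw [h, h']; ring

theorem HasLogExtension.mul_left {f : ℂ → ℂ} (hf : HasLogExtension f) {a : ℂ → ℂ}
    (ha : ∀ z, AnalyticAt ℂ a z) : HasLogExtension (fun k => a k * f k) := by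
  obtain ⟨F, h1, h2, h3⟩ := hf
  refine ⟨fun k => a k * F k, fun k hk => congrArg (a k * ·) (h1 k hk),
    fun k hk => (ha k).mul (h2 k hk), fun s hs => ?_⟩
  obtain ⟨u₁, u₂, hu₁, hu₂, hu⟩ := h3 s hs
  refine ⟨fun k => a k * u₁ k, fun k => a k * u₂ k, (ha s).mul hu₁, (ha s).mul hu₂, ?_⟩
  filter_upwards [hu] with k h
  rw [h]; ring

theorem hasLogExtension_const (c : ℂ) : HasLogExtension (fun _ => c) :=
  ⟨fun _ => c, fun _ _ => rfl, fun _ _ => analyticAt_const, fun _ _ =>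
    ⟨0, fun _ => c, analyticAt_const, analyticAt_const, Eventually.of_forall fun k => by simp⟩⟩

theorem exists_ofReal_eq_of_mem_branchPoints {s : ℂ} (hs : s ∈ branchPoints) :
    ∃ x : ℝ, s = x := by
  simp only [branchPoints, mem_insert_iff, mem_singleton_iff] at hs
  rcases hs with rfl | rfl | rfl | rfl | rfl
  · exact ⟨0, by simp⟩
  · exact ⟨2, by simp⟩
  · exact ⟨-2, by simp⟩
  · exact ⟨_, rfl⟩
  · exact ⟨-√8, by simp⟩

theorem finite_branchPoints : branchPoints.Finite := by
  simp [branchPoints]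

/-- The local charts at real points glue to a global extension. -/
theorem hasLogExtension_of_hasLogSingularity {g : ℂ → ℂ}
    (hg : AnalyticOnNhd ℂ g (closedUpper \ cut)) (hloc : ∀ x : ℝ, HasLogSingularity g x) :
    HasLogExtension g := by
  choose u₁ u₂ hu₁ hu₂ hu0 hu using hloc
  let f : ℝ → ℂ → ℂ := fun x k => u₁ x k * logBranch (k - x) + u₂ x k
  have hr : ∀ x : ℝ, ∃ r > 0, (∀ k ∈ Metric.ball (x : ℂ) r, AnalyticAt ℂ (u₁ x) k ∧
      AnalyticAt ℂ (u₂ x) k ∧ (k ∈ openUpper → g k = f x k)) ∧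
      ∀ s ∈ branchPoints \ {(x : ℂ)}, r ≤ dist (x : ℂ) s / 2 := by
    intro x
    have h1 := hu x
    rw [eventually_nhdsWithin_iff] at h1
    obtain ⟨r, hr, hb⟩ := Metric.eventually_nhds_iff_ball.1
      ((hu₁ x).eventually_analyticAt.and ((hu₂ x).eventually_analyticAt.and h1))
    have hcl : (branchPoints \ {(x : ℂ)})ᶜ ∈ 𝓝 (x : ℂ) :=
      (finite_branchPoints.subset sdiff_subset).isClosed.isOpen_compl.mem_nhds (by simp)
    obtain ⟨δ, hδ, hδb⟩ := Metric.mem_nhds_iff.1 hcl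
    -- The factor `1/2` keeps the ball about `x` clear of the vertical rays below all other branch
    -- points.
    refine ⟨min r (δ / 2), by positivity, fun k hk => ?_, fun s hs => ?_⟩
    · exact hb k (Metric.ball_subset_ball (min_le_left _ _) hk)
    · have : δ ≤ dist (x : ℂ) s := by
        by_contra! h
        exact hδb (by rwa [Metric.mem_ball, dist_comm]) hs
      exact (min_le_right _ _).trans (by linarith)
  choose r hrpos hrb hrs using hr
  let V : ℝ → Set ℂ := fun x => {k | k ∈ Metric.ball (x : ℂ) (r x) ∧
    ((x : ℂ) ∈ branchPoints → k ∈ slitPlaneAt x)}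
  have hfan : ∀ x, ∀ k ∈ V x, AnalyticAt ℂ (f x) k := by
    rintro x k ⟨hk, hkb⟩
    obtain ⟨h1, h2, -⟩ := hrb x k hk
    by_cases hx : (x : ℂ) ∈ branchPoints
    · have h3 : ¬ ((k - (x : ℂ)).re = 0 ∧ (k - (x : ℂ)).im ≤ 0) := by
        rintro ⟨h4, h5⟩
        rw [Complex.sub_re, sub_eq_zero] at h4
        rw [Complex.sub_im, sub_nonpos] at h5
        exact hkb hx ⟨h4, h5⟩
      have h6 : AnalyticAt ℂ (fun k => logBranch (k - x)) k := by
        unfold logBranch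
        refine AnalyticAt.add (AnalyticAt.clog (by fun_prop) (neg_I_mul_mem_slitPlane h3))
          analyticAt_const
      exact (h1.mul h6).add h2
    · have : f x = u₂ x := by funext k; simp [f, hu0 x hx]
      rw [this]; exact h2
  have hUV : ∀ x, ∀ k ∈ V x, k ∈ openUpper → g k = f x k := fun x k hk => (hrb x k hk.1).2.2
  have hre : ∀ (x : ℝ) (k : ℂ), k ∈ Metric.ball (x : ℂ) (r x) → (k.re : ℂ) ∈ Metric.ball (x : ℂ) (r x) := by
    intro x k hk
    rw [Metric.mem_ball, Complex.dist_eq] at hk ⊢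
    refine lt_of_le_of_lt ?_ hk
    rw [← Complex.ofReal_sub, Complex.norm_real, Real.norm_eq_abs]
    simpa using Complex.abs_re_le_norm (k - x)
  have hslit : ∀ x y : ℝ, x ≠ y → ∀ k, k ∈ Metric.ball (x : ℂ) (r x) → (y : ℂ) ∈ branchPoints →
      k ∈ slitPlaneAt y := by
    rintro x y hxy k hk hy ⟨h1, -⟩
    have h2 := hre x k hk
    rw [h1, Complex.ofReal_re] at h2
    have h3 := hrs x y ⟨hy, by simpa using hxy.symm⟩
    rw [Metric.mem_ball, dist_comm] at h2
    have := dist_nonneg (x := (x : ℂ)) (y := y)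
    linarith
  have hagree : ∀ x y : ℝ, ∀ k, k ∈ V x → k ∈ V y → f x k = f y k := by
    intro x y k hkx hky
    rcases eq_or_ne x y with rfl | hxy
    · rfl
    have hsubx : Metric.ball (x : ℂ) (r x) ∩ Metric.ball (y : ℂ) (r y) ⊆ V x :=
      fun z hz => ⟨hz.1, hslit y x hxy.symm z hz.2⟩
    have hsuby : Metric.ball (x : ℂ) (r x) ∩ Metric.ball (y : ℂ) (r y) ⊆ V y :=
      fun z hz => ⟨hz.2, hslit x y hxy z hz.1⟩
    have hopen : IsOpen (Metric.ball (x : ℂ) (r x) ∩ Metric.ball (y : ℂ) (r y)) :=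
      Metric.isOpen_ball.inter Metric.isOpen_ball
    -- Both balls are centred on the real axis, so they contain the projection `k.re`, and a point
    -- slightly above it lies in the upper half plane. There both charts equal `g`, and the convex
    -- intersection lets the identity theorem spread the agreement.
    obtain ⟨z, hzU, hzx⟩ : ∃ z ∈ openUpper, z ∈ Metric.ball (x : ℂ) (r x) ∩ Metric.ball (y : ℂ) (r y) := by
      have hc : Tendsto (fun t : ℝ => (k.re : ℂ) + t * Complex.I) (𝓝[>] 0) (𝓝 (k.re : ℂ)) := by
        have : Continuous fun t : ℝ => (k.re : ℂ) + t * Complex.I := by fun_prop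
        have := (this.tendsto 0)
        simp only [Complex.ofReal_zero, zero_mul, add_zero] at this
        exact this.mono_left nhdsWithin_le_nhds
      obtain ⟨t, ht, ht0⟩ := ((hc.eventually (hopen.mem_nhds ⟨hre x k hkx.1, hre y k hky.1⟩)).and
        self_mem_nhdsWithin).exists
      exact ⟨_, by simpa [openUpper] using ht0, ht⟩
    refine AnalyticOnNhd.eqOn_of_preconnected_of_eventuallyEq (fun z hz => hfan x z (hsubx hz))
      (fun z hz => hfan y z (hsuby hz))
      ((convex_ball _ _).inter (convex_ball _ _)).isPreconnected hzx ?_ ⟨hkx.1, hky.1⟩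
    filter_upwards [hopen.mem_nhds hzx, isOpen_openUpper.mem_nhds hzU] with w hw hwU
    rw [← hUV x w (hsubx hw) hwU, hUV y w (hsuby hw) hwU]
  classical
  let F : ℂ → ℂ := fun k => if k ∈ openUpper then g k else
    if h : ∃ x, k ∈ V x then f h.choose k else 0
  have hFU : ∀ k ∈ openUpper, F k = g k := fun k hk => if_pos hk
  have hFV : ∀ x, ∀ k ∈ V x, F k = f x k := by
    intro x k hk
    by_cases hkU : k ∈ openUpper
    · rw [hFU k hkU, hUV x k hk hkU]
    · have hex : ∃ x, k ∈ V x := ⟨x, hk⟩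
      simp only [F]
      rw [if_neg hkU, dif_pos hex]
      exact hagree _ _ k hex.choose_spec hk
  have hUcut : ∀ k ∈ openUpper, k ∈ closedUpper \ cut := fun k (hk : 0 < k.im) =>
    ⟨show 0 ≤ k.im from hk.le, fun h => hk.ne' h.1⟩
  have hreal : ∀ k ∈ closedUpper, k ∉ openUpper → k = (k.re : ℂ) := by
    intro k h1 h2
    exact Complex.ext rfl (by simpa using le_antisymm (not_lt.1 h2) h1)
  have hballV : ∀ x : ℝ, (x : ℂ) ∉ branchPoints → V x = Metric.ball (x : ℂ) (r x) := by
    intro x hx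
    ext k
    exact ⟨fun h => h.1, fun h => ⟨h, fun h' => absurd h' hx⟩⟩
  refine ⟨F, ?_, ?_, ?_⟩
  · intro k hk
    by_cases hkU : k ∈ openUpper
    · exact hFU k hkU
    · have hkr := hreal k hk.1 hkU
      set x := k.re with hx
      have hxb : (x : ℂ) ∉ branchPoints := by
        intro hb
        apply hk.2
        rw [hkr]
        have h8 : (2 : ℝ) ≤ √8 := by
          rw [Real.le_sqrt' (by norm_num)]; norm_num
        refine ⟨Complex.ofReal_im x, ?_⟩
        rw [Complex.ofReal_re]
        simp only [branchPoints, mem_insert_iff, mem_singleton_iff] at hb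
        rcases hb with h | h | h | h | h
        · have : x = 0 := by exact_mod_cast h
          constructor <;> linarith
        · have : x = 2 := by exact_mod_cast h
          constructor <;> linarith
        · have : x = -2 := by exact_mod_cast h
          constructor <;> linarith
        · have : x = √8 := by exact_mod_cast h
          constructor <;> linarith
        · have : x = -√8 := by exact_mod_cast h
          constructor <;> linarith
      have hkV : k ∈ V x := by
        rw [hballV x hxb, hkr]; exact Metric.mem_ball_self (hrpos x)
      rw [hFV x k hkV]
      -- At a real point off the cut, the chart and `g` are both continuous and agree from above,
      -- hence at the point.
      have hc1 : Tendsto (f x) (𝓝[openUpper] k) (𝓝 (f x k)) :=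
        (hfan x k hkV).continuousAt.tendsto.mono_left nhdsWithin_le_nhds
      have hc2 : Tendsto g (𝓝[openUpper] k) (𝓝 (g k)) :=
        (hg k hk).continuousAt.tendsto.mono_left nhdsWithin_le_nhds
      have hne : (𝓝[openUpper] k).NeBot := by
        rw [← mem_closure_iff_nhdsWithin_neBot, openUpper, Complex.closure_setOfPred_lt_im]
        exact hk.1
      refine tendsto_nhds_unique hc1 (hc2.congr' ?_)
      have hball : Metric.ball (x : ℂ) (r x) ∈ 𝓝 k := by
        rw [hkr]; exact Metric.ball_mem_nhds _ (hrpos x)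
      filter_upwards [nhdsWithin_le_nhds hball, self_mem_nhdsWithin] with z hz hzU
      exact (hrb x z hz).2.2 hzU
  · intro k hk
    by_cases hkU : k ∈ openUpper
    · refine (hg k (hUcut k hkU)).congr ?_
      filter_upwards [isOpen_openUpper.mem_nhds hkU] with z hz using (hFU z hz).symm
    · have hkr := hreal k hk.1 hkU
      have hxb : ((k.re : ℝ) : ℂ) ∉ branchPoints := by rw [← hkr]; exact hk.2
      have hball : V k.re ∈ 𝓝 k := by
        rw [hballV _ hxb]
        refine Metric.isOpen_ball.mem_nhds ?_
        rw [Metric.mem_ball, ← hkr, dist_self]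
        exact hrpos _
      refine (hfan _ k (mem_of_mem_nhds hball)).congr ?_
      filter_upwards [hball] with z hz using (hFV _ z hz).symm
  · intro s hs
    obtain ⟨x, rfl⟩ := exists_ofReal_eq_of_mem_branchPoints hs
    refine ⟨u₁ x, u₂ x, hu₁ x, hu₂ x, ?_⟩
    filter_upwards [nhdsWithin_le_nhds (Metric.ball_mem_nhds (x : ℂ) (hrpos x)),
      self_mem_nhdsWithin] with k hk hks
    exact hFV x k ⟨hk, fun _ => hks⟩

theorem one_sub_sq_div_mem_compl_unitCut {k : ℂ} (hk : k ∉ cut) : 1 - k ^ 2 / 4 ∈ unitCutᶜ := by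
  rintro ⟨h1, h2, h3⟩
  set e := 1 - k ^ 2 / 4 with he
  have hee : e = (e.re : ℂ) := Complex.ext rfl (by simpa using h1)
  have hksq : k ^ 2 = ((4 - 4 * e.re : ℝ) : ℂ) := by
    push_cast
    rw [← hee, he]; ring
  have him : k.im = 0 := im_eq_zero_of_sq (by linarith) hksq
  have hkr : k = (k.re : ℂ) := Complex.ext rfl (by simpa using him)
  have h4 : k.re ^ 2 = 4 - 4 * e.re := by
    rw [hkr] at hksq
    exact_mod_cast hksq
  refine hk ⟨him, ?_⟩
  exact abs_le.1 (Real.abs_le_sqrt (by linarith))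

theorem isClosed_cut : IsClosed cut := by
  have : cut = (fun e : ℂ => e.im) ⁻¹' {0} ∩ (fun e : ℂ => e.re) ⁻¹' Icc (-√8 : ℝ) √8 := rfl
  rw [this]
  exact (isClosed_singleton.preimage Complex.continuous_im).inter
    (isClosed_Icc.preimage Complex.continuous_re)

theorem hasLogExtension_diagTransform {p : ℂ → ℂ} (hp : Differentiable ℂ p) :
    HasLogExtension (fun k => diagTransform p (1 - k ^ 2 / 4)) := by
  refine hasLogExtension_of_hasLogSingularity ?_ (hasLogSingularity_diagTransform hp)
  intro k hk
  exact AnalyticAt.comp (g := diagTransform p) (f := fun k : ℂ => 1 - k ^ 2 / 4)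
    ((differentiableOn_diagTransform hp.continuous).analyticAt
      (isOpen_compl_unitCut.mem_nhds (one_sub_sq_div_mem_compl_unitCut hk.2)))
    (analyticAt_one_sub_sq_div k)


/-! ### Green's function: convergence, analyticity and symmetries. -/

theorem symbol_nonneg (σ : ℝ × ℝ) : 0 ≤ symbol σ := by
  unfold symbol; linarith [Real.cos_le_one σ.1, Real.cos_le_one σ.2]

theorem symbol_le_eight (σ : ℝ × ℝ) : symbol σ ≤ 8 := by
  unfold symbol; linarith [Real.neg_one_le_cos σ.1, Real.neg_one_le_cos σ.2]

theorem symbol_sub_sq_ne_zero {k : ℂ} (hk : k ∉ cut) (σ : ℝ × ℝ) : (symbol σ : ℂ) - k ^ 2 ≠ 0 := by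
  intro h
  have hksq : k ^ 2 = (symbol σ : ℂ) := by linear_combination -h
  have him : k.im = 0 := im_eq_zero_of_sq (symbol_nonneg σ) hksq
  have hkr : k = (k.re : ℂ) := Complex.ext rfl (by simpa using him)
  have h4 : k.re ^ 2 = symbol σ := by
    rw [hkr] at hksq
    exact_mod_cast hksq
  exact hk ⟨him, abs_le.1 (Real.abs_le_sqrt (by linarith [symbol_le_eight σ]))⟩

theorem continuousOn_greenIntegrand (ξ : ℤ × ℤ) :
    ContinuousOn (Function.uncurry fun k σ => greenIntegrand k ξ σ) (cutᶜ ×ˢ univ) := by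
  unfold greenIntegrand symbol
  refine ContinuousOn.div (Continuous.continuousOn (by fun_prop))
    (Continuous.continuousOn (by fun_prop)) ?_
  rintro ⟨k, σ⟩ ⟨hk, -⟩
  exact symbol_sub_sq_ne_zero hk σ

theorem continuous_greenIntegrand {k : ℂ} (hk : k ∉ cut) (ξ : ℤ × ℤ) :
    Continuous (greenIntegrand k ξ) := by
  have := (continuousOn_greenIntegrand ξ).comp (f := fun σ : ℝ × ℝ => (k, σ)) (s := univ)
    (by fun_prop) (fun σ _ => ⟨hk, mem_univ σ⟩)
  exact continuousOn_univ.1 this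

theorem torusSquare_subset : torusSquare ⊆ Icc (-Real.pi) Real.pi ×ˢ Icc (-Real.pi) Real.pi :=
  prod_mono Ioo_subset_Icc_self Ioo_subset_Icc_self

theorem integrableOn_torusSquare {f : ℝ × ℝ → ℂ} (hf : Continuous f) :
    IntegrableOn f torusSquare :=
  (hf.continuousOn.integrableOn_compact (isCompact_Icc.prod isCompact_Icc)).mono_set
    torusSquare_subset

theorem measurableSet_torusSquare : MeasurableSet torusSquare :=
  measurableSet_Ioo.prod measurableSet_Ioo

theorem analyticOnNhd_green (ξ : ℤ × ℤ) : AnalyticOnNhd ℂ (fun k => green k ξ) cutᶜ := by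
  refine DifferentiableOn.analyticOnNhd (DifferentiableOn.const_mul ?_ _) isClosed_cut.isOpen_compl
  refine differentiableOn_setIntegral isClosed_cut.isOpen_compl
    (isCompact_Icc.prod isCompact_Icc) measurableSet_torusSquare torusSquare_subset
    ((continuousOn_greenIntegrand ξ).mono (prod_mono subset_rfl (subset_univ _))) ?_
  intro σ _
  unfold greenIntegrand
  exact DifferentiableOn.div (by fun_prop) (by fun_prop) fun k hk => symbol_sub_sq_ne_zero hk σ

theorem green_swap (k : ℂ) (a b : ℤ) : green k (b, a) = green k (a, b) := by
  unfold green
  congr 1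
  rw [torusSquare, Measure.volume_eq_prod, ← setIntegral_prod_swap]
  refine integral_congr_ae (Eventually.of_forall fun σ => ?_)
  simp only [greenIntegrand, symbol, Prod.fst_swap, Prod.snd_swap]
  congr 1
  · congr 3
    ring
  · congr 2
    ring

theorem setIntegral_torusSquare {f : ℝ × ℝ → ℂ} (hf : Continuous f) :
    ∫ σ in torusSquare, f σ
      = ∫ s in (-Real.pi)..Real.pi, ∫ t in (-Real.pi)..Real.pi, f (s, t) := by
  have hpi : -Real.pi ≤ Real.pi := by linarith [Real.pi_pos]
  have h := integrableOn_torusSquare hf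
  rw [torusSquare, Measure.volume_eq_prod] at h ⊢
  rw [setIntegral_prod _ h, intervalIntegral.integral_of_le hpi, integral_Ioc_eq_integral_Ioo]
  refine setIntegral_congr_fun measurableSet_Ioo fun s _ => ?_
  rw [intervalIntegral.integral_of_le hpi, integral_Ioc_eq_integral_Ioo]

theorem green_neg_left {k : ℂ} (hk : k ∉ cut) (a b : ℤ) : green k (-a, b) = green k (a, b) := by
  unfold green
  congr 1
  rw [setIntegral_torusSquare (continuous_greenIntegrand hk _),
    setIntegral_torusSquare (continuous_greenIntegrand hk _)]
  have := intervalIntegral.integral_comp_neg (a := -Real.pi) (b := Real.pi)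
    (fun s : ℝ => ∫ t in (-Real.pi)..Real.pi, greenIntegrand k (a, b) (s, t))
  rw [neg_neg] at this
  rw [← this]
  refine intervalIntegral.integral_congr fun s _ => ?_
  refine intervalIntegral.integral_congr fun t _ => ?_
  simp [greenIntegrand, symbol]

theorem green_neg_right {k : ℂ} (hk : k ∉ cut) (a b : ℤ) : green k (a, -b) = green k (a, b) := by
  rw [green_swap, green_neg_left hk, green_swap]

/-! ### The lattice equation. -/

/-- The integral of the exponential `e^{i σ ξ}`, in the normalisation of Green's function. -/
noncomputable def greenSource (ξ : ℤ × ℤ) : ℂ :=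
  (1 / (2 * (Real.pi : ℂ))) * ∫ σ in torusSquare,
    Complex.exp (Complex.I * ((σ.1 * ξ.1 + σ.2 * ξ.2 : ℝ) : ℂ))

/-- The difference equation `(-Δ - k²) G = δ` (up to normalisation). -/
theorem green_lattice_equation {k : ℂ} (hk : k ∉ cut) (x y : ℤ) :
    (4 - k ^ 2) * green k (x, y) = green k (x + 1, y) + green k (x - 1, y) + green k (x, y + 1)
      + green k (x, y - 1) + greenSource (x, y) := by
  unfold green greenSource
  have hi : ∀ ξ, IntegrableOn (greenIntegrand k ξ) torusSquare := fun ξ =>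
    integrableOn_torusSquare (continuous_greenIntegrand hk ξ)
  have hsum : ∫ σ in torusSquare, (4 - k ^ 2) * greenIntegrand k (x, y) σ
      = ∫ σ in torusSquare, (greenIntegrand k (x + 1, y) σ + greenIntegrand k (x - 1, y) σ
        + greenIntegrand k (x, y + 1) σ + greenIntegrand k (x, y - 1) σ
        + Complex.exp (Complex.I * ((σ.1 * (x, y).1 + σ.2 * (x, y).2 : ℝ) : ℂ))) := by
    refine integral_congr_ae (Eventually.of_forall fun σ => ?_)
    have hne := symbol_sub_sq_ne_zero hk σ
    simp only [greenIntegrand]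
    rw [mul_div_assoc', ← add_div, ← add_div, ← add_div, div_add' _ _ _ hne]
    congr 1
    have hexp : ∀ u v : ℂ, Complex.exp (Complex.I * (u + v))
        = Complex.exp (Complex.I * u) * Complex.exp (v * Complex.I) := by
      intro u v; rw [← Complex.exp_add]; congr 1; ring
    have e1 : Complex.exp (Complex.I * ((σ.1 * ((x + 1 : ℤ) : ℝ) + σ.2 * (y : ℝ) : ℝ) : ℂ))
        = Complex.exp (Complex.I * ((σ.1 * x + σ.2 * y : ℝ) : ℂ)) * Complex.exp (σ.1 * Complex.I) := by
      rw [← hexp]; congr 2; push_cast; ring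
    have e2 : Complex.exp (Complex.I * ((σ.1 * ((x - 1 : ℤ) : ℝ) + σ.2 * (y : ℝ) : ℝ) : ℂ))
        = Complex.exp (Complex.I * ((σ.1 * x + σ.2 * y : ℝ) : ℂ)) * Complex.exp (-σ.1 * Complex.I) := by
      rw [← hexp]; congr 2; push_cast; ring
    have e3 : Complex.exp (Complex.I * ((σ.1 * (x : ℝ) + σ.2 * ((y + 1 : ℤ) : ℝ) : ℝ) : ℂ))
        = Complex.exp (Complex.I * ((σ.1 * x + σ.2 * y : ℝ) : ℂ)) * Complex.exp (σ.2 * Complex.I) := by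
      rw [← hexp]; congr 2; push_cast; ring
    have e4 : Complex.exp (Complex.I * ((σ.1 * (x : ℝ) + σ.2 * ((y - 1 : ℤ) : ℝ) : ℝ) : ℂ))
        = Complex.exp (Complex.I * ((σ.1 * x + σ.2 * y : ℝ) : ℂ)) * Complex.exp (-σ.2 * Complex.I) := by
      rw [← hexp]; congr 2; push_cast; ring
    rw [e1, e2, e3, e4, symbol]
    push_cast
    have c1 := Complex.two_cos (σ.1 : ℂ)
    have c2 := Complex.two_cos (σ.2 : ℂ)
    rw [c1, c2]
    ring
  have hexpi : IntegrableOn (fun σ : ℝ × ℝ =>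
      Complex.exp (Complex.I * ((σ.1 * (x, y).1 + σ.2 * (x, y).2 : ℝ) : ℂ))) torusSquare :=
    integrableOn_torusSquare (by fun_prop)
  rw [integral_const_mul] at hsum
  have hadd : ∀ {f g : ℝ × ℝ → ℂ}, IntegrableOn f torusSquare → IntegrableOn g torusSquare →
      IntegrableOn (fun σ => f σ + g σ) torusSquare := fun hf hg => hf.add hg
  rw [integral_add (hadd (hadd (hadd (hi _) (hi _)) (hi _)) (hi _)) hexpi,
    integral_add (hadd (hadd (hi _) (hi _)) (hi _)) (hi _),
    integral_add (hadd (hi _) (hi _)) (hi _), integral_add (hi _) (hi _)] at hsum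
  rw [mul_left_comm, hsum]
  ring

/-! ### Green's function on the diagonal. -/

theorem integral_symm_eq_integral_add {f : ℝ → ℂ} (hf : Continuous f) (b : ℝ) :
    ∫ x in -b..b, f x = ∫ x in (0 : ℝ)..b, (f x + f (-x)) := by
  rw [← intervalIntegral.integral_add_adjacent_intervals (b := 0) (hf.intervalIntegrable _ _)
    (hf.intervalIntegrable _ _), intervalIntegral.integral_add (g := fun x => f (-x))
    (hf.intervalIntegrable _ _) ((hf.comp continuous_neg).intervalIntegrable _ _)]
  have := intervalIntegral.integral_comp_neg (a := 0) (b := b) f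
  rw [neg_zero] at this
  rw [this]; ring

theorem integral_periodic_comp_sub {f : ℝ → ℂ} (hf : Function.Periodic f (2 * Real.pi)) (d : ℝ) :
    ∫ x in (-Real.pi)..Real.pi, f (x - d) = ∫ x in (-Real.pi)..Real.pi, f x := by
  rw [intervalIntegral.integral_comp_sub_right f d]
  have := hf.intervalIntegral_add_eq (-Real.pi - d) (-Real.pi)
  convert this using 2 <;> ring

/-- Rotating the torus by `π / 4`. -/
theorem integral_torus_rotate {f : ℝ → ℝ → ℂ} (hf : Continuous (Function.uncurry f))
    (h1 : ∀ t, Function.Periodic (fun s => f s t) (2 * Real.pi))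
    (h2 : ∀ s, Function.Periodic (f s) (2 * Real.pi)) :
    ∫ s in (-Real.pi)..Real.pi, ∫ t in (-Real.pi)..Real.pi, f s t
      = ∫ t in (-Real.pi)..Real.pi, ∫ a in (-Real.pi)..Real.pi, f (a + t / 2) (t / 2 - a) := by
  -- The rotation is done as two translations, each in one variable of a periodic function: `t ↦ t -
  -- s` for fixed `s`, then, after the swap, `s ↦ a + t/2` for fixed `t`.
  have hA : ∫ s in (-Real.pi)..Real.pi, ∫ t in (-Real.pi)..Real.pi, f s t
      = ∫ s in (-Real.pi)..Real.pi, ∫ t in (-Real.pi)..Real.pi, f s (t - s) :=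
    intervalIntegral.integral_congr fun s _ => (integral_periodic_comp_sub (h2 s) s).symm
  have hc : Continuous (Function.uncurry fun s t => f s (t - s)) :=
    hf.comp (f := fun q : ℝ × ℝ => (q.1, q.2 - q.1)) (by fun_prop)
  rw [hA, intervalIntegral_intervalIntegral_swap]
  · refine intervalIntegral.integral_congr fun t _ => ?_
    have hp : Function.Periodic (fun s => f s (t - s)) (2 * Real.pi) := by
      intro s
      have e1 := h1 (t - (s + 2 * Real.pi)) s
      have e2 := h2 s (t - (s + 2 * Real.pi))
      simp only at e1 e2 ⊢
      rw [e1, ← e2]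
      congr 1
      ring
    have := integral_periodic_comp_sub hp (-(t / 2))
    refine this.symm.trans ?_
    refine intervalIntegral.integral_congr fun a _ => ?_
    congr 1 <;> ring
  · exact (hc.continuousOn.integrableOn_compact (isCompact_uIcc.prod isCompact_uIcc)).mono_set
      (prod_mono uIoc_subset_uIcc uIoc_subset_uIcc)

/-- On the diagonal Green's function reduces to a resolvent integral in rotated coordinates. -/
theorem green_diag {k : ℂ} (hk : k ∉ cut) (n : ℤ) :
    green k (n, n) = 1 / (Real.pi : ℂ) *
      diagTransform (fun z => (Polynomial.Chebyshev.T ℂ n).eval (1 - 2 * z)) (1 - k ^ 2 / 4) := by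
  set e : ℂ := 1 - k ^ 2 / 4 with he
  have heI : e ∈ unitCutᶜ := one_sub_sq_div_mem_compl_unitCut hk
  have hrot := integral_torus_rotate (f := fun s t => greenIntegrand k (n, n) (s, t))
    (continuous_greenIntegrand hk _) ?_ ?_
  rotate_left
  · intro t s
    simp only [greenIntegrand, symbol, Real.cos_add_two_pi]
    congr 1
    rw [Complex.exp_eq_exp_iff_exists_int]
    exact ⟨n, by push_cast; ring⟩
  · intro s t
    simp only [greenIntegrand, symbol, Real.cos_add_two_pi]
    congr 1
    rw [Complex.exp_eq_exp_iff_exists_int]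
    exact ⟨n, by push_cast; ring⟩
  let R : ℝ → ℝ → ℂ := fun c a => (e - ((Real.cos c * Real.cos a : ℝ) : ℂ))⁻¹
  have hRne : ∀ c a : ℝ, e - ((Real.cos c * Real.cos a : ℝ) : ℂ) ≠ 0 := by
    intro c a
    refine sub_ofReal_ne_zero_of_notMem heI (abs_le.1 ?_)
    rw [abs_mul]
    exact mul_le_one₀ (Real.abs_cos_le_one c) (abs_nonneg _) (Real.abs_cos_le_one a)
  have hRc : Continuous (Function.uncurry R) :=
    Continuous.inv₀ (by fun_prop) fun q => hRne q.1 q.2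
  -- With `σ₁ = a + t/2` and `σ₂ = t/2 - a`, the phase `n (σ₁ + σ₂) = n t` does not involve `a`.
  have hint : ∀ t a : ℝ, greenIntegrand k (n, n) (a + t / 2, t / 2 - a)
      = 1 / 4 * Complex.exp (Complex.I * ((n * t : ℝ) : ℂ)) * R (t / 2) a := by
    intro t a
    have hcos : symbol (a + t / 2, t / 2 - a) = 4 - 4 * (Real.cos (t / 2) * Real.cos a) := by
      simp only [symbol]
      rw [Real.cos_add, Real.cos_sub]; ring
    simp only [greenIntegrand, R]
    rw [hcos, show (((4 - 4 * (Real.cos (t / 2) * Real.cos a) : ℝ) : ℂ) - k ^ 2)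
      = 4 * (e - ((Real.cos (t / 2) * Real.cos a : ℝ) : ℂ)) by rw [he]; push_cast; ring,
      show (a + t / 2) * (n : ℝ) + (t / 2 - a) * n = n * t by ring, div_eq_mul_inv, mul_inv]
    ring
  have hRa : ∀ c : ℝ, Continuous (R c) := fun c =>
    hRc.comp (f := fun a : ℝ => (c, a)) (by fun_prop)
  have hinner : ∀ c : ℝ, ∫ a in (-Real.pi)..Real.pi, R c a = 2 * ∫ a in (0 : ℝ)..Real.pi, R c a := by
    intro c
    rw [integral_symm_eq_integral_add (hRa c), ← intervalIntegral.integral_const_mul]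
    refine intervalIntegral.integral_congr fun a _ => ?_
    simp only [R, Real.cos_neg]
    ring
  let K : ℝ → ℂ := fun c => ∫ a in (0 : ℝ)..Real.pi, R c a
  have hKc : Continuous K := intervalIntegral.continuous_parametric_intervalIntegral_of_continuous' hRc _ _
  have hKneg : ∀ c, K (-c) = K c := fun c => by simp only [K, R, Real.cos_neg]
  have houter : ∫ s in (-Real.pi)..Real.pi, ∫ t in (-Real.pi)..Real.pi,
      greenIntegrand k (n, n) (s, t)
      = ∫ t in (-Real.pi)..Real.pi, 1 / 2 * Complex.exp (Complex.I * ((n * t : ℝ) : ℂ)) * K (t / 2) := by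
    rw [hrot]
    refine intervalIntegral.integral_congr fun t _ => ?_
    simp only [hint]
    rw [intervalIntegral.integral_const_mul, hinner]
    simp only [K]
    ring
  have hfold : ∫ t in (-Real.pi)..Real.pi, 1 / 2 * Complex.exp (Complex.I * ((n * t : ℝ) : ℂ)) * K (t / 2)
      = ∫ t in (0 : ℝ)..Real.pi, Complex.cos (n * t) * K (t / 2) := by
    rw [integral_symm_eq_integral_add (by fun_prop)]
    refine intervalIntegral.integral_congr fun t _ => ?_
    rw [neg_div, hKneg, Complex.cos]
    push_cast
    rw [mul_neg, mul_neg, neg_mul, mul_comm Complex.I ((n : ℂ) * t)]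
    ring
  have hscale := intervalIntegral.integral_comp_mul_left (a := 0) (b := Real.pi / 2)
    (fun t : ℝ => Complex.cos (n * t) * K (t / 2)) (two_ne_zero (α := ℝ))
  rw [mul_zero, mul_div_cancel₀ _ (two_ne_zero (α := ℝ)), Complex.real_smul] at hscale
  -- `T_n (1 - 2 sin² c) = T_n (cos 2c) = cos 2nc`, which accounts for the choice of `p`.
  have hD : diagTransform (fun z => (Polynomial.Chebyshev.T ℂ n).eval (1 - 2 * z)) e
      = ∫ c in (0 : ℝ)..(Real.pi / 2), Complex.cos (n * ((2 * c : ℝ) : ℂ)) * K (2 * c / 2) := by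
    rw [diagTransform, intervalIntegral.integral_of_le (by positivity), integral_Ioc_eq_integral_Ioo]
    refine setIntegral_congr_fun measurableSet_Ioo fun c _ => ?_
    rw [integral_const_mul, mul_div_cancel_left₀ _ (two_ne_zero (α := ℝ)),
      ← Polynomial.Chebyshev.T_complex_cos]
    congr 1
    · congr 1
      push_cast
      rw [Complex.cos_two_mul, Complex.sin_sq]
      ring
    · simp only [K, R]
      rw [intervalIntegral.integral_of_le Real.pi_pos.le, integral_Ioc_eq_integral_Ioo]
  rw [green, setIntegral_torusSquare (continuous_greenIntegrand hk _), houter, hfold, hD, hscale]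
  have hpi : (Real.pi : ℂ) ≠ 0 := by exact_mod_cast Real.pi_ne_zero
  push_cast
  field_simp

theorem hasLogExtension_green_diag (n : ℤ) : HasLogExtension (fun k => green k (n, n)) := by
  refine HasLogExtension.congr ((hasLogExtension_diagTransform
    (p := fun z => (Polynomial.Chebyshev.T ℂ n).eval (1 - 2 * z)) ?_).mul_left
    (a := fun _ => 1 / (Real.pi : ℂ)) fun _ => analyticAt_const) fun k hk => (green_diag hk.2 n).symm
  exact (Polynomial.differentiable (Polynomial.Chebyshev.T ℂ n)).comp
    (f := fun z : ℂ => 1 - 2 * z) (by fun_prop)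

/-! ### From the diagonal to all lattice points. -/

theorem HasLogExtension.sub {f g : ℂ → ℂ} (hf : HasLogExtension f) (hg : HasLogExtension g) :
    HasLogExtension (fun k => f k - g k) :=
  (hf.add (hg.mul_left (a := fun _ => -1) fun _ => analyticAt_const)).congr fun k _ => by ring

/-- Induction on the distance to the diagonal. The lattice equation at a point of line `d` involves
two points of line `d - 1` and two adjacent points of line `d + 1`, so sums of adjacent values on
the new line are under control. One value on that line then determines all the others, and a
reflection supplies that value. -/
theorem hasLogExtension_green_of_sub_eq (d : ℕ) :
    ∀ a b : ℤ, a - b = d → HasLogExtension (fun k => green k (a, b)) := by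
  induction d using Nat.strong_induction_on with
  | _ d ih =>
  rcases d with _ | d
  · intro a b hab
    obtain rfl : a = b := by simpa [sub_eq_zero] using hab
    exact hasLogExtension_green_diag a
  -- The source term is constant in `k`, so its value is never needed.
  have hcentre : ∀ x y : ℤ, HasLogExtension (fun k => green k (x, y)) →
      HasLogExtension (fun k => (4 - k ^ 2) * green k (x, y) - greenSource (x, y)) := fun x y h =>
    (h.mul_left (a := fun k => 4 - k ^ 2) fun _ => by fun_prop).sub (hasLogExtension_const _)
  have hsum : ∀ x y : ℤ, x - y = d →
      HasLogExtension (fun k => green k (x + 1, y) + green k (x, y - 1)) := by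
    intro x y hxy
    have hc := hcentre x y (ih d (by omega) x y hxy)
    -- For `d = 0` the four neighbours are equal in pairs by the swap symmetry, whence the factor
    -- `1/2`.
    rcases Nat.eq_zero_or_pos d with h0 | hpos
    · subst h0
      obtain rfl : x = y := by simpa [sub_eq_zero] using hxy
      refine (hc.mul_left (a := fun _ => 1 / 2) fun _ => analyticAt_const).congr fun k hk => ?_
      have h1 := green_lattice_equation hk.2 x x
      rw [green_swap k x (x - 1), green_swap k (x + 1) x] at h1
      rw [h1]; ring
    · have h1 := ih (d - 1) (by omega) (x - 1) y (by omega)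
      have h2 := ih (d - 1) (by omega) x (y + 1) (by omega)
      refine ((hc.sub h1).sub h2).congr fun k hk => ?_
      have h1 := green_lattice_equation hk.2 x y
      rw [h1]; ring
  have hup : ∀ a b : ℤ, a - b = d + 1 → HasLogExtension (fun k => green k (a, b)) →
      HasLogExtension (fun k => green k (a + 1, b + 1)) := by
    intro a b hab h
    refine ((hsum a (b + 1) (by omega)).sub h).congr fun k _ => ?_
    rw [add_sub_cancel_right]; ring
  have hdown : ∀ a b : ℤ, a - b = d + 1 → HasLogExtension (fun k => green k (a, b)) →
      HasLogExtension (fun k => green k (a - 1, b - 1)) := by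
    intro a b hab h
    refine ((hsum (a - 1) b (by omega)).sub h).congr fun k _ => ?_
    rw [sub_add_cancel]; ring
  -- If `d = 2m`, the adjacent points `(m, -m-1)` and `(m+1, -m)` have equal values, so half their
  -- sum suffices. If `d = 2m + 1`, the point `(m+1, -(m+1))` reflects to the diagonal.
  have hbase : ∃ a b : ℤ, a - b = d + 1 ∧ HasLogExtension (fun k => green k (a, b)) := by
    rcases Nat.even_or_odd' d with ⟨m, hm | hm⟩
    · refine ⟨m + 1, -m, by omega, ?_⟩
      refine ((hsum m (-m) (by omega)).mul_left (a := fun _ => 1 / 2)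
        fun _ => analyticAt_const).congr fun k hk => ?_
      have h1 : green k ((m : ℤ), -(m : ℤ) - 1) = green k ((m : ℤ) + 1, -(m : ℤ)) := by
        rw [green_neg_right hk.2, green_swap, ← neg_add', green_neg_left hk.2]
      rw [h1]; ring
    · refine ⟨m + 1, -(m + 1), by omega, ?_⟩
      refine (hasLogExtension_green_diag (m + 1)).congr fun k hk => ?_
      exact (green_neg_right hk.2 _ _).symm
  obtain ⟨a₀, b₀, hab₀, h₀⟩ := hbase
  have hall : ∀ j : ℤ, HasLogExtension (fun k => green k (a₀ + j, b₀ + j)) := by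
    intro j
    induction j using Int.induction_on with
    | zero => simpa using h₀
    | succ i hi =>
      have := hup _ _ (by omega) hi
      rwa [add_assoc, add_assoc] at this
    | pred i hi =>
      have := hdown _ _ (by omega) hi
      rwa [add_sub_assoc, add_sub_assoc] at this
  intro a b hab
  have := hall (a - a₀)
  rwa [show a₀ + (a - a₀) = a by ring, show b₀ + (a - a₀) = b by push_cast at hab; omega] at this

theorem hasLogExtension_green (ξ : ℤ × ℤ) : HasLogExtension (fun k => green k ξ) := by
  obtain ⟨a, b⟩ := ξ
  rcases le_total b a with h | h
  · exact hasLogExtension_green_of_sub_eq (a - b).toNat a b (by omega)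
  · refine (hasLogExtension_green_of_sub_eq (b - a).toNat b a (by omega)).congr fun k _ => ?_
    exact green_swap k a b

end LatticeGreen

theorem theorem1 (ξ : ℤ × ℤ) :
    -- the integral defining Green's function makes sense
    (∀ k ∈ LatticeGreen.closedUpper \ LatticeGreen.cut,
      (∀ σ ∈ LatticeGreen.torusSquare, (LatticeGreen.symbol σ : ℂ) - k ^ 2 ≠ 0) ∧
      IntegrableOn (LatticeGreen.greenIntegrand k ξ) LatticeGreen.torusSquare) ∧
    -- Green's function is analytic off the segment
    AnalyticOnNhd ℂ (fun k => LatticeGreen.green k ξ)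
      (LatticeGreen.closedUpper \ LatticeGreen.cut) ∧
    -- it extends analytically, with logarithmic behaviour at the branch points
    ∃ F : ℂ → ℂ,
      (∀ k ∈ LatticeGreen.closedUpper \ LatticeGreen.cut, F k = LatticeGreen.green k ξ) ∧
      AnalyticOnNhd ℂ F (LatticeGreen.closedUpper \ LatticeGreen.branchPoints) ∧
      ∀ s ∈ LatticeGreen.branchPoints, ∃ u₁ u₂ : ℂ → ℂ,
        AnalyticAt ℂ u₁ s ∧ AnalyticAt ℂ u₂ s ∧
        ∀ᶠ k in 𝓝[LatticeGreen.slitPlaneAt s] s,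
          F k = u₁ k * LatticeGreen.logBranch (k - s) + u₂ k := by
  refine ⟨fun k hk => ⟨fun σ _ => LatticeGreen.symbol_sub_sq_ne_zero hk.2 σ,
    LatticeGreen.integrableOn_torusSquare (LatticeGreen.continuous_greenIntegrand hk.2 ξ)⟩,
    fun k hk => LatticeGreen.analyticOnNhd_green ξ k hk.2, LatticeGreen.hasLogExtension_green ξ⟩
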